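/- Consider $n$ items of which $k=k(n)$ are defective, where $k(n)=\Theta(n^\theta)$ for a fixed $\theta\in(0,1)$. In Bernoulli nonadaptive group testing with $T$ tests and parameter $p\in[0,1]$, each item is placed in each test independently with probability $p$; a test is positive if it contains at least one defective item and negative otherwise. A detection algorithm maps the design and the test outcomes (and possibly $n,k,T$) to an estimate $\hat{\mathcal K}$ of the defective set; its error probability is $\binom nk^{-1}\sum_{|\mathcal K|=k}\mathbb P(\hat{\mathcal K}\neq\mathcal K)$, where the probability is over the random design and $\mathcal K$ is the true defective set. A rate $R$ is achievable by an algorithm if for every $\epsilon>0$ and all sufficiently large $n$ there are $p=p(n)$ and $T=T(n)\ge 1$ such that $\log_2\binom nk/T>R$ and the error probability is less than $\epsilon$. The DD algorithm calls an item a possible defective if it is in no negative test, and declares a possible defective to be defective exactly when some test contains it and no other possible defective; all other items are declared nondefective. Let $R^*_{\mathrm{DD}}$ be the supremum of the rates achievable by DD. Then $$R^*_{\mathrm{DD}}\le\max_{\nu>0}\min\left\{\mathrm e^{-\nu}\log_2\mathrm e^{\nu}+\nu\,\mathrm e^{-\nu}\log_2\frac1{1-\mathrm e^{-\nu}},\ \frac{\nu}{\mathrm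 e^{\nu}\ln 2}\,\frac{1-\theta}{\theta}\right\}.$$ In particular, DD is strictly suboptimal for $\theta<\theta^*$, where $$\theta^*=\frac1{2-\ln(1-\mathrm e^{-1})}\approx 0.407\ \text{(to three decimal places)};$$ that is, for such $\theta$, $R^*_{\mathrm{DD}}$ is strictly less than the capacity of Bernoulli nonadaptive group testing (the supremum of the rates achievable by any detection algorithm), and strictly less than the value given by the capacity formula $$C=\max_{\nu>0}\min\left\{h(\mathrm e^{-\nu}),\ \frac{\nu}{\mathrm e^{\nu}\ln 2}\,\frac{1-\theta}{\theta}\right\},\qquad h(q)=q\log_2\frac1q+(1-q)\log_2\frac1{1-q}.$$ -/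

import Mathlib

noncomputable section

namespace GroupTesting

/-- A nonadaptive design with `T` tests on `n` items: `x t i = true` when item `i` is in the pool
of test `t`. -/
abbrev Design (T n : ℕ) : Type := Fin T → Fin n → Bool

/-- The law of the Bernoulli design with parameter `p`: the entries `x t i` are independent, each
equal to `true` with probability `p` and to `false` with probability `1 - p`. -/
def bernoulliDesign (T n : ℕ) (p : unitInterval) : MeasureTheory.Measure (Design T n) :=
  MeasureTheory.Measure.pi fun _ : Fin T =>
    MeasureTheory.Measure.pi fun _ : Fin n => ProbabilityTheory.bernoulliMeasure true false p

/-- The outcomes of the tests when `K` is the defective set: a test is positive (`true`) when its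
pool contains an item of `K`, and negative (`false`) otherwise. -/
def outcome {T n : ℕ} (x : Design T n) (K : Finset (Fin n)) : Fin T → Bool :=
  fun t => decide (∃ i ∈ K, x t i = true)

/-- A detection algorithm computes an estimate of the defective set from the number of items `n`,
the number of defectives `k`, the number of tests `T`, the design and the test outcomes. (It may
ignore `k`.) -/
abbrev DetectionAlgorithm : Type :=
  ∀ n _k T : ℕ, Design T n → (Fin T → Bool) → Finset (Fin n)

/-- The possible defectives: the items that are in no negative test. -/
def possibleDefectives {T n : ℕ} (x : Design T n) (y : Fin T → Bool) : Finset (Fin n) :=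
  {i | ∀ t, x t i = true → y t = true}

/-- The definite defectives: the possible defectives `i` for which some test contains `i` and no
other possible defective. -/
def definiteDefectives {T n : ℕ} (x : Design T n) (y : Fin T → Bool) : Finset (Fin n) :=
  {i ∈ possibleDefectives x y |
    ∃ t, x t i = true ∧ ∀ j ∈ possibleDefectives x y, x t j = true → j = i}

/-- The DD algorithm declares exactly the definite defectives to be defective. -/
def DD : DetectionAlgorithm := fun _ _ _ x y => definiteDefectives x y

/-- The average error probability, with `n` items, `k` defectives, `T` tests and Bernoulli
parameter `p`: the average over all defective sets `K` of size `k` of the probability, over the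
random design, that the estimate differs from `K`. -/
def errorProbability (A : DetectionAlgorithm) (n k T : ℕ) (p : unitInterval) : ℝ :=
  (1 / (n.choose k : ℝ)) * ∑ K ∈ Finset.powersetCard k (Finset.univ : Finset (Fin n)),
    (bernoulliDesign T n p).real {x | A n k T x (outcome x K) ≠ K}

/-- The rate `R` is achievable by the algorithm `A`, with `k n` defectives among `n` items: for
every `ε > 0` and all sufficiently large `n` there are a Bernoulli parameter and a (positive) number
of tests with rate `log₂ (n choose k) / T` above `R` and error probability below `ε`. -/
def Achievable (A : DetectionAlgorithm) (k : ℕ → ℕ) (R : ℝ) : Prop :=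
  ∀ ε : ℝ, 0 < ε → ∀ᶠ n : ℕ in Filter.atTop, ∃ (p : unitInterval) (T : ℕ), 0 < T ∧
    R < Real.logb 2 (n.choose (k n) : ℝ) / T ∧ errorProbability A n (k n) T p < ε

/-- The maximum achievable rate of the algorithm `A`: the supremum, in the extended reals, of its
achievable rates. -/
def maxRate (A : DetectionAlgorithm) (k : ℕ → ℕ) : EReal :=
  ⨆ R : {R : ℝ // Achievable A k R}, ((R : ℝ) : EReal)

/-- The capacity of Bernoulli nonadaptive group testing: the maximum achievable rate over all
detection algorithms. -/
def capacity (k : ℕ → ℕ) : EReal := ⨆ A : DetectionAlgorithm, maxRate A k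

/-- The minimum `min {e^{-ν} log₂ e^ν + ν e^{-ν} log₂ (1 / (1 - e^{-ν})),
(ν / (e^ν ln 2)) (1 - θ) / θ}`. -/
def ddMinimum (θ ν : ℝ) : ℝ :=
  min (Real.exp (-ν) * Real.logb 2 (Real.exp ν)
      + ν * Real.exp (-ν) * Real.logb 2 (1 / (1 - Real.exp (-ν))))
    (ν / (Real.exp ν * Real.log 2) * ((1 - θ) / θ))

/-- The minimum `min {h (e^{-ν}), (ν / (e^ν ln 2)) (1 - θ) / θ}`, where `h` is the binary entropy
in bits (Mathlib's `Real.binEntropy` is in nats). -/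
def capacityMinimum (θ ν : ℝ) : ℝ :=
  min (Real.binEntropy (Real.exp (-ν)) / Real.log 2)
    (ν / (Real.exp ν * Real.log 2) * ((1 - θ) / θ))

/-- The threshold `θ* = 1 / (2 - ln (1 - e^{-1}))`. -/
def thetaStar : ℝ := 1 / (2 - Real.log (1 - Real.exp (-1)))

end GroupTesting

end

noncomputable section

namespace GroupTesting

open Filter Topology

/-! Everything about DD follows from one bound, stronger than the one asked for: by `maxRate_DD_le`
its rate is at most min {1, (1 - θ) / θ} / (e ln 2). Already at ν = 1 the function `ddMinimum θ` is
at least this large. So its maximum bounds the rate, and for strict suboptimality it is enough to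
beat 1 / (e ln 2).

Converse. Let L = log n, and let ρ = p (1 - p)^(k - 1) be the probability that a test contains a
given defective and no other one. Whatever p is, ρ ≤ 1 / (e (k - 1)). As log (n choose k) is about
(1 - θ) k L, a rate above the bound forces T ρ ≤ v L for some v < max {θ, 1 - θ}. If v < θ, the
expected number of defectives that are alone among the defectives in no test is about k n^(-v) or
more, which diverges, and a second moment argument shows that such a defective probably exists
(`eventually_definiteDefectives_le_of_lt`). If v < 1 - θ, the number N of negative tests satisfies N
≲ T (1 - p)^k, so that p N ≲ T ρ (1 - p). A nondefective then lies in a given positive test and in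
no negative one with probability about p n^(-v) or more. The expected number of such nondefectives
is at least a positive power of n, so a fixed defective is hidden in every test
(`eventually_definiteDefectives_le_of_lt_one_sub`). Either way DD succeeds with probability at most
1/4.

Achievability (`exists_achievable_gt`). Take p = 1 / k and T about e c k L, and output any k-set
that explains the outcomes. Exchanging l defectives for l nondefectives must respect the roughly c k
L negative tests, which costs a factor n^(-c l) against an effective count of (n / k)^l up to
constants. This alone would ask for c > 1 - θ, that is, a rate below 1 / (e ln 2). The tests meeting
the defective set only in the exchanged items give a further fixed power of n^(-l), so some c < 1 -
θ works. That every l-subset has enough such tests needs c > θ, which is possible because θ < 1/2.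
The threshold θ* enters only through θ* < 1/2. -/

/-- The mass that the Bernoulli distribution with parameter `p` gives to a Boolean. -/
def bitWeight (p : ℝ) (b : Bool) : ℝ := if b then p else 1 - p

/-- The mean of a function of a vector of independent Bernoulli bits. -/
def rowMean {ι : Type*} [Fintype ι] [DecidableEq ι] (p : ℝ) (F : (ι → Bool) → ℝ) : ℝ :=
  ∑ r, (∏ i, bitWeight p (r i)) * F r

/-- The mean of a function of a matrix of independent Bernoulli bits. -/
def designMean {τ ι : Type*} [Fintype τ] [DecidableEq τ] [Fintype ι] [DecidableEq ι] (p : ℝ)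
    (F : (τ → ι → Bool) → ℝ) : ℝ :=
  ∑ x, (∏ t, ∏ i, bitWeight p (x t i)) * F x

/-! ### Means of functions of independent bits as finite sums -/

section Means

variable {τ ι : Type*} [Fintype τ] [DecidableEq τ] [Fintype ι] [DecidableEq ι]

lemma bitWeight_nonneg {p : ℝ} (h0 : 0 ≤ p) (h1 : p ≤ 1) (b : Bool) : 0 ≤ bitWeight p b := by
  unfold bitWeight; split_ifs <;> linarith

lemma sum_bitWeight (p : ℝ) : ∑ b, bitWeight p b = 1 := by
  simp [bitWeight]

lemma rowMean_add (p : ℝ) (F G : (ι → Bool) → ℝ) :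
    rowMean p (fun r => F r + G r) = rowMean p F + rowMean p G := by
  simp [rowMean, mul_add, Finset.sum_add_distrib]

lemma rowMean_sub (p : ℝ) (F G : (ι → Bool) → ℝ) :
    rowMean p (fun r => F r - G r) = rowMean p F - rowMean p G := by
  simp [rowMean, mul_sub, Finset.sum_sub_distrib]

lemma rowMean_const_mul (p c : ℝ) (F : (ι → Bool) → ℝ) :
    rowMean p (fun r => c * F r) = c * rowMean p F := by
  simp only [rowMean, Finset.mul_sum]
  exact Finset.sum_congr rfl fun _ _ => by ring

/-- Independence of the bits: distributivity turns the sum over vectors of products into a product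
of sums. -/
lemma rowMean_prod (p : ℝ) (f : ι → Bool → ℝ) :
    rowMean p (fun r => ∏ i, f i (r i)) = ∏ i, ∑ b, bitWeight p b * f i b := by
  simp only [rowMean, ← Finset.prod_mul_distrib]
  rw [Finset.prod_univ_sum, Fintype.piFinset_univ]

lemma rowMean_const (p c : ℝ) : rowMean p (fun _ : ι → Bool => c) = c := by
  have h := rowMean_prod (ι := ι) p (fun _ _ => 1)
  simp only [Finset.prod_const_one, mul_one, sum_bitWeight] at h
  have h2 := rowMean_const_mul (ι := ι) p c (fun _ => 1)
  simpa [h] using h2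

lemma rowMean_nonneg {p : ℝ} (h0 : 0 ≤ p) (h1 : p ≤ 1) {F : (ι → Bool) → ℝ}
    (h : ∀ r, 0 ≤ F r) : 0 ≤ rowMean p F :=
  Finset.sum_nonneg fun r _ =>
    mul_nonneg (Finset.prod_nonneg fun _ _ => bitWeight_nonneg h0 h1 _) (h r)

lemma designMean_prod (p : ℝ) (F : τ → (ι → Bool) → ℝ) :
    designMean p (fun x => ∏ t, F t (x t)) = ∏ t, rowMean p (F t) := by
  simp only [designMean, rowMean, ← Finset.prod_mul_distrib]
  rw [Finset.prod_univ_sum, Fintype.piFinset_univ]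

lemma designMean_add (p : ℝ) (F G : (τ → ι → Bool) → ℝ) :
    designMean p (fun x => F x + G x) = designMean p F + designMean p G := by
  simp [designMean, mul_add, Finset.sum_add_distrib]

lemma designMean_const_mul (p c : ℝ) (F : (τ → ι → Bool) → ℝ) :
    designMean p (fun x => c * F x) = c * designMean p F := by
  simp only [designMean, Finset.mul_sum]
  exact Finset.sum_congr rfl fun _ _ => by ring

lemma designMean_sum {κ : Type*} (s : Finset κ) (p : ℝ) (F : κ → (τ → ι → Bool) → ℝ) :
    designMean p (fun x => ∑ j ∈ s, F j x) = ∑ j ∈ s, designMean p (F j) := by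
  simp only [designMean, Finset.mul_sum]
  exact Finset.sum_comm

lemma designMean_const (p c : ℝ) : designMean p (fun _ : τ → ι → Bool => c) = c := by
  have h := designMean_prod (τ := τ) (ι := ι) p (fun _ _ => 1)
  simp only [Finset.prod_const_one, rowMean_const] at h
  have h2 := designMean_const_mul (τ := τ) (ι := ι) p c (fun _ => 1)
  simpa [h] using h2

lemma designMean_mono {p : ℝ} (h0 : 0 ≤ p) (h1 : p ≤ 1) {F G : (τ → ι → Bool) → ℝ}
    (h : ∀ x, F x ≤ G x) : designMean p F ≤ designMean p G :=
  Finset.sum_le_sum fun x _ => mul_le_mul_of_nonneg_left (h x)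
    (Finset.prod_nonneg fun _ _ => Finset.prod_nonneg fun _ _ => bitWeight_nonneg h0 h1 _)

/-- The indicator of the event that no bit in `A` is set. -/
def avoid (A : Finset ι) (r : ι → Bool) : ℝ := ∏ i ∈ A, if r i then 0 else 1

open Classical in
omit [Fintype ι] [DecidableEq ι] in
lemma avoid_eq_ite (A : Finset ι) (r : ι → Bool) :
    avoid A r = if ∃ i ∈ A, r i = true then 0 else 1 := by
  unfold avoid
  split_ifs with h
  · obtain ⟨i, hi, hr⟩ := h
    exact Finset.prod_eq_zero hi (by simp [hr])
  · push Not at h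
    exact Finset.prod_eq_one fun i hi => by simp [h i hi]

omit [Fintype ι] in
lemma avoid_mul_avoid {A B : Finset ι} (h : Disjoint A B) (r : ι → Bool) :
    avoid A r * avoid B r = avoid (A ∪ B) r :=
  (Finset.prod_union h).symm

omit [Fintype ι] in
lemma avoid_insert {A : Finset ι} {i : ι} (h : i ∉ A) (r : ι → Bool) :
    avoid (insert i A) r = (if r i then 0 else 1) * avoid A r :=
  Finset.prod_insert h

lemma rowMean_avoid (p : ℝ) (A : Finset ι) : rowMean p (avoid A) = (1 - p) ^ A.card := by
  have h : avoid A = fun r : ι → Bool => ∏ i, (if i ∈ A then (if r i then (0 : ℝ) else 1) else 1) := by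
    funext r
    simp [avoid, Finset.prod_ite_mem]
  rw [h, rowMean_prod p (fun i b => if i ∈ A then (if b then (0 : ℝ) else 1) else 1)]
  have h2 : ∀ i, ∑ b, bitWeight p b * (if i ∈ A then (if b then (0 : ℝ) else 1) else 1)
      = if i ∈ A then 1 - p else 1 := by
    intro i
    by_cases hi : i ∈ A <;> simp [hi, bitWeight]
  simp_rw [h2]
  rw [Finset.prod_ite_mem]
  simp

/-- The indicator of the event that `i` is the only element of `K` whose bit is set. -/
def sole (K : Finset ι) (i : ι) (r : ι → Bool) : ℝ := avoid (K.erase i) r - avoid K r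

open Classical in
lemma sole_eq_ite {K : Finset ι} {i : ι} (hi : i ∈ K) (r : ι → Bool) :
    sole K i r = if r i = true ∧ ∀ j ∈ K, r j = true → j = i then 1 else 0 := by
  have e : avoid K r = (if r i then 0 else 1) * avoid (K.erase i) r := by
    rw [← avoid_insert (Finset.notMem_erase i K), Finset.insert_erase hi]
  have h : (∃ j ∈ K.erase i, r j = true) ↔ ¬ ∀ j ∈ K, r j = true → j = i := by
    push Not
    simp only [Finset.mem_erase]
    exact ⟨fun ⟨j, hj, hr⟩ => ⟨j, hj.2, hr, hj.1⟩, fun ⟨j, hj, hr, hne⟩ => ⟨j, ⟨hne, hj⟩, hr⟩⟩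
  have hc : avoid (K.erase i) r = if ∀ j ∈ K, r j = true → j = i then 1 else 0 := by
    rw [avoid_eq_ite]
    by_cases h' : ∀ j ∈ K, r j = true → j = i
    · rw [if_pos h', if_neg (by rw [h]; exact not_not.2 h')]
    · rw [if_neg h', if_pos (h.2 h')]
  rw [sole, e, hc, ite_and]
  split_ifs <;> simp

lemma rowMean_sole (p : ℝ) {K : Finset ι} {i : ι} (hi : i ∈ K) :
    rowMean p (sole K i) = p * (1 - p) ^ (K.card - 1) := by
  have h : sole K i = fun r => avoid (K.erase i) r - avoid K r := rfl
  have hk : K.card = K.card - 1 + 1 := by have := Finset.card_pos.2 ⟨i, hi⟩; omega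
  rw [h, rowMean_sub, rowMean_avoid, rowMean_avoid, Finset.card_erase_of_mem hi]
  nth_rw 2 [hk]
  ring

/-- A Chernoff bound, for the upper tail (`0 ≤ l`) and the lower tail (`l ≤ 0`) at once. -/
lemma designMean_chernoff {p : ℝ} (h0 : 0 ≤ p) (h1 : p ≤ 1) (z : (ι → Bool) → ℝ)
    (hz : ∀ r, z r = 0 ∨ z r = 1) (l b : ℝ) (P : (τ → ι → Bool) → Prop) [DecidablePred P]
    (hP : ∀ x, P x → l * b ≤ l * ∑ t, z (x t)) :
    designMean p (fun x => if P x then 1 else 0) ≤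
      Real.exp (Fintype.card τ * (rowMean p z * (Real.exp l - 1)) - l * b) := by
  -- Since `z` takes only the values 0 and 1, its exponential is affine in `z`, so its mean needs
  -- only the mean of `z`.
  have hexp : ∀ r, Real.exp (l * z r) = 1 + (Real.exp l - 1) * z r := by
    intro r; rcases hz r with h | h <;> simp [h]
  have hm : rowMean p (fun r => Real.exp (l * z r)) = 1 + (Real.exp l - 1) * rowMean p z := by
    simp_rw [hexp]
    rw [rowMean_add, rowMean_const, rowMean_const_mul]
  have hm0 : 0 ≤ rowMean p (fun r => Real.exp (l * z r)) :=
    rowMean_nonneg h0 h1 fun r => (Real.exp_pos _).le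
  calc designMean p (fun x => if P x then 1 else 0)
      ≤ designMean p (fun x => Real.exp (-(l * b)) * ∏ t, Real.exp (l * z (x t))) := by
        refine designMean_mono h0 h1 fun x => ?_
        rw [← Real.exp_sum, ← Real.exp_add, ← Finset.mul_sum]
        split_ifs with h
        · exact Real.one_le_exp (by linarith [hP x h])
        · exact (Real.exp_pos _).le
    _ = Real.exp (-(l * b)) * rowMean p (fun r => Real.exp (l * z r)) ^ Fintype.card τ := by
        rw [designMean_const_mul, designMean_prod p (fun _ r => Real.exp (l * z r))]
        simp
    _ ≤ Real.exp (-(l * b)) *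
          Real.exp ((Real.exp l - 1) * rowMean p z) ^ Fintype.card τ := by
        gcongr
        rw [hm, add_comm]
        exact Real.add_one_le_exp _
    _ = _ := by
        rw [← Real.exp_nat_mul, ← Real.exp_add]
        congr 1; ring

end Means

-- The design space is finite, so the product measure of an event is a sum of point masses; all
-- later estimates are about finite sums.
open Classical in
lemma bernoulliDesign_real (T n : ℕ) (p : unitInterval) (S : Set (Design T n)) :
    (bernoulliDesign T n p).real S =
      designMean (p : ℝ) (fun x : Design T n => if x ∈ S then 1 else 0) := by
  have hS : S = ((Finset.univ.filter (· ∈ S) : Finset (Design T n)) : Set (Design T n)) := by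
    ext; simp
  have : MeasureTheory.IsProbabilityMeasure (bernoulliDesign T n p) := by
    unfold bernoulliDesign; infer_instance
  conv_lhs => rw [hS]
  rw [← MeasureTheory.sum_measureReal_singleton, Finset.sum_filter]
  unfold designMean
  refine Finset.sum_congr rfl fun x _ => ?_
  have hx : (bernoulliDesign T n p).real {x} = ∏ t, ∏ i, bitWeight p (x t i) := by
    simp only [bernoulliDesign, MeasureTheory.measureReal_def, MeasureTheory.Measure.pi_singleton,
      ENNReal.toReal_prod]
    refine Finset.prod_congr rfl fun t _ => Finset.prod_congr rfl fun i _ => ?_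
    rw [← MeasureTheory.measureReal_def, ProbabilityTheory.bernoulliMeasure_real_apply p
      (MeasurableSet.singleton _)]
    cases x t i <;> simp [bitWeight]
  rw [hx]
  by_cases h : x ∈ S <;> simp [h]

/-! ### Conditioning on the columns of the defectives -/

section Columns

variable {ι α : Type*} [Fintype ι] [DecidableEq ι] [Fintype α]

/-- Conditioning a product weight on the coordinates in `K`: the coordinates outside `K` are
independent of them. -/
lemma sum_prod_weight_split (K : Finset ι) (w : α → ℝ) (a : α) (f : (ι → α) → ℝ)
    (g : (ι → α) → α → ℝ)
    (hf : ∀ y y' : ι → α, (∀ i ∈ K, y i = y' i) → f y = f y')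
    (hg : ∀ y y' : ι → α, (∀ i ∈ K, y i = y' i) → g y = g y') :
    ∑ y : ι → α, (∏ i, w (y i)) * (f y * ∏ j ∈ Kᶜ, g y (y j)) =
      ∑ u : {i // i ∈ K} → α, (∏ i, w (u i)) *
        (f ((Equiv.piEquivPiSubtypeProd (· ∈ K) fun _ => α).symm (u, fun _ => a)) *
          (∑ c, w c * g ((Equiv.piEquivPiSubtypeProd (· ∈ K) fun _ => α).symm (u, fun _ => a)) c)
            ^ Kᶜ.card) := by
  -- The value `a` is only a filler outside `K`: `f` and `g` depend on the coordinates in `K` alone,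
  -- so any filler gives the same result.
  set e := Equiv.piEquivPiSubtypeProd (· ∈ K) fun _ => α with he
  rw [← Equiv.sum_comp e.symm, Fintype.sum_prod_type]
  refine Finset.sum_congr rfl fun u _ => ?_
  have hagree : ∀ v : {i // i ∉ K} → α, ∀ i ∈ K, e.symm (u, v) i = e.symm (u, fun _ => a) i := by
    intro v i hi
    simp [he, hi]
  have hin : ∀ v, ∀ i : {i // i ∈ K}, e.symm (u, v) i = u i := by
    intro v i; simp [he]
  have hout : ∀ v, ∀ i : {i // i ∉ K}, e.symm (u, v) i = v i := by
    intro v i; simp [he, i.2]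
  have hterm : ∀ v : {i // i ∉ K} → α,
      (∏ i, w (e.symm (u, v) i)) * (f (e.symm (u, v)) * ∏ j ∈ Kᶜ, g (e.symm (u, v)) (e.symm (u, v) j))
      = (∏ i, w (u i)) * (f (e.symm (u, fun _ => a)) *
        ∏ j, (w (v j) * g (e.symm (u, fun _ => a)) (v j))) := by
    intro v
    rw [hf _ _ (hagree v), hg _ _ (hagree v)]
    have h1 : ∏ i, w (e.symm (u, v) i) = (∏ i, w (u i)) * ∏ j, w (v j) := by
      rw [← Fintype.prod_subtype_mul_prod_subtype (· ∈ K)]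
      simp only [hin, hout]
      congr 1
      refine Finset.prod_congr ?_ fun _ _ => rfl
      ext; simp
    have h2 : ∏ j ∈ Kᶜ, g (e.symm (u, fun _ => a)) (e.symm (u, v) j)
        = ∏ j, g (e.symm (u, fun _ => a)) (v j) := by
      rw [Finset.prod_subtype (F := inferInstance) (p := fun i => i ∉ K) Kᶜ (by simp)
        (fun j => g (e.symm (u, fun _ => a)) (e.symm (u, v) j))]
      simp only [hout]
    rw [h1, h2, Finset.prod_mul_distrib]
    ring
  rw [Finset.sum_congr rfl fun v _ => hterm v, ← Finset.mul_sum, ← Finset.mul_sum]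
  congr 2
  have h3 := Finset.prod_univ_sum (fun _ : {i // i ∉ K} => (Finset.univ : Finset α))
    (fun _ c => w c * g (e.symm (u, fun _ => a)) c)
  rw [Fintype.piFinset_univ] at h3
  rw [← h3, Finset.prod_const]
  congr 1
  rw [Finset.card_univ, Fintype.card_subtype]
  congr 1
  ext; simp

end Columns

section Columns

variable {τ ι : Type*} [Fintype τ] [DecidableEq τ] [Fintype ι] [DecidableEq ι]

/-- Reading the matrix by items instead of by tests makes the columns the independent coordinates,
as `sum_prod_weight_split` requires. -/
lemma designMean_swap (p : ℝ) (F : (τ → ι → Bool) → ℝ) :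
    designMean p F = ∑ y : ι → τ → Bool, (∏ i, ∏ t, bitWeight p (y i t)) * F fun t i => y i t := by
  unfold designMean
  rw [← Equiv.sum_comp (Equiv.piComm fun (_ : ι) (_ : τ) => Bool)]
  refine Finset.sum_congr rfl fun y _ => ?_
  rw [Finset.prod_comm]
  rfl

/-- If, given the columns in `K`, each further column contributes a factor of conditional mean at
most `b`, then the mean is at most `b` to the number of further columns times the mean without
these factors. -/
lemma designMean_columns_le {p : ℝ} (h0 : 0 ≤ p) (h1 : p ≤ 1) (K : Finset ι)
    (f : (τ → ι → Bool) → ℝ) (g : (τ → ι → Bool) → (τ → Bool) → ℝ) {b : ℝ}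
    (hf : ∀ x y : τ → ι → Bool, (∀ t, ∀ i ∈ K, x t i = y t i) → f x = f y)
    (hg : ∀ x y : τ → ι → Bool, (∀ t, ∀ i ∈ K, x t i = y t i) → g x = g y)
    (hf0 : ∀ x, 0 ≤ f x) (hg0 : ∀ x c, 0 ≤ g x c)
    (hb : ∀ x, f x ≠ 0 → rowMean p (g x) ≤ b) :
    designMean p (fun x => f x * ∏ j ∈ Kᶜ, g x fun t => x t j) ≤
      designMean p f * b ^ Kᶜ.card := by
  have hfs : ∀ y y' : ι → τ → Bool, (∀ i ∈ K, y i = y' i) →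
      f (fun t i => y i t) = f (fun t i => y' i t) :=
    fun y y' h => hf _ _ fun t i hi => congrFun (h i hi) t
  have key := sum_prod_weight_split K (fun c : τ → Bool => ∏ t, bitWeight p (c t))
    (fun _ => false) (fun y => f fun t i => y i t) (fun y => g fun t i => y i t) hfs
    (fun y y' h => hg _ _ fun t i hi => congrFun (h i hi) t)
  have key1 := sum_prod_weight_split K (fun c : τ → Bool => ∏ t, bitWeight p (c t))
    (fun _ => false) (fun y => f fun t i => y i t) (fun _ _ => 1) hfs (fun _ _ _ => rfl)
  have hone : ∑ c : τ → Bool, (∏ t, bitWeight p (c t)) * (1 : ℝ) = 1 := rowMean_const p 1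
  simp only [Finset.prod_const_one] at key1
  rw [hone] at key1
  simp only [one_pow, mul_one] at key1
  rw [designMean_swap, designMean_swap, key, key1, Finset.sum_mul]
  refine Finset.sum_le_sum fun u _ => ?_
  rw [mul_assoc]
  refine mul_le_mul_of_nonneg_left ?_ (Finset.prod_nonneg fun _ _ =>
    Finset.prod_nonneg fun _ _ => bitWeight_nonneg h0 h1 _)
  by_cases hz : f (fun t i => (Equiv.piEquivPiSubtypeProd (· ∈ K) fun _ => τ → Bool).symm
      (u, fun _ _ => false) i t) = 0
  · rw [hz]; simp
  · refine mul_le_mul_of_nonneg_left ?_ (hf0 _)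
    exact pow_le_pow_left₀ (rowMean_nonneg h0 h1 (hg0 _)) (hb _ hz) _

end Columns

/-! ### DD success probability: second and first moment bounds for fixed `n` -/

section Converse

variable {T n : ℕ}

lemma outcome_eq_true {x : Design T n} {K : Finset (Fin n)} {t : Fin T} :
    outcome x K t = true ↔ ∃ i ∈ K, x t i = true := by
  simp [outcome]

lemma subset_possibleDefectives (x : Design T n) (K : Finset (Fin n)) :
    K ⊆ possibleDefectives x (outcome x K) := by
  intro i hi
  simp only [possibleDefectives, Finset.mem_filter, Finset.mem_univ, true_and]
  exact fun t ht => outcome_eq_true.2 ⟨i, hi, ht⟩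

lemma exists_test_of_definiteDefectives_eq {x : Design T n} {K : Finset (Fin n)}
    (h : definiteDefectives x (outcome x K) = K) {i : Fin n} (hi : i ∈ K) :
    ∃ t, x t i = true ∧ ∀ j ∈ possibleDefectives x (outcome x K), x t j = true → j = i := by
  rw [← h, definiteDefectives, Finset.mem_filter] at hi
  exact hi.2

/-- Every defective is a possible defective, so being the only possible defective in a test implies
being the only defective there. The nondefectives are forgotten. -/
lemma exists_sole_of_definiteDefectives_eq {x : Design T n} {K : Finset (Fin n)}
    (h : definiteDefectives x (outcome x K) = K) {i : Fin n} (hi : i ∈ K) :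
    ∃ t, sole K i (x t) = 1 := by
  obtain ⟨t, ht, h2⟩ := exists_test_of_definiteDefectives_eq h hi
  refine ⟨t, ?_⟩
  rw [sole_eq_ite hi, if_pos ⟨ht, fun j hj => h2 j (subset_possibleDefectives x K hj)⟩]

/-- Every defective must be the only defective in some test: a second moment bound. -/
lemma designMean_definiteDefectives_le_inv {p : ℝ} (h0 : 0 ≤ p) (h1 : p ≤ 1)
    {K : Finset (Fin n)} (hK : K.Nonempty) {ρ : ℝ} (hρ : ρ = p * (1 - p) ^ (K.card - 1))
    (hρ2 : ρ ≤ 1 / 2) :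
    designMean p (fun x : Design T n => if definiteDefectives x (outcome x K) = K then 1 else 0) ≤
      1 / (K.card * (1 - ρ) ^ T) := by
  set m : ℝ := K.card * (1 - ρ) ^ T with hm
  have hm0 : 0 < m := by
    have : (0 : ℝ) < K.card := by exact_mod_cast hK.card_pos
    have : 0 < 1 - ρ := by linarith
    positivity
  -- For `i` in `K`, this is the indicator that `i` is the only defective in no test. If DD
  -- succeeds, the sum of the `u i` over `K` vanishes, while its mean is `m`.
  let u : Fin n → Design T n → ℝ := fun i x => ∏ t, (1 - sole K i (x t))
  have hu : ∀ i ∈ K, designMean p (u i) = (1 - ρ) ^ T := by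
    intro i hi
    simp only [u]
    rw [designMean_prod p (fun _ r => 1 - sole K i r)]
    simp [rowMean_sub, rowMean_const, rowMean_sole p hi, hρ]
  have huu : ∀ i ∈ K, designMean p (fun x => u i x * u i x) = (1 - ρ) ^ T := by
    intro i hi
    rw [← hu i hi]
    congr 1
    funext x
    simp only [u]
    rw [← Finset.prod_mul_distrib]
    refine Finset.prod_congr rfl fun t _ => ?_
    rw [sole_eq_ite hi]
    split_ifs <;> norm_num
  -- Two defectives cannot both be alone in one test, so a test is useless to both with probability
  -- 1 - 2ρ ≤ (1 - ρ)²: the indicators are negatively correlated. Taking powers uses 1 - 2ρ ≥ 0,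
  -- hence ρ ≤ 1/2.
  have huv : ∀ i ∈ K, ∀ j ∈ K, i ≠ j →
      designMean p (fun x => u i x * u j x) ≤ (1 - ρ) ^ T * (1 - ρ) ^ T := by
    intro i hi j hj hij
    have e : (fun x => u i x * u j x) =
        fun x : Design T n => ∏ t, (1 - sole K i (x t) - sole K j (x t)) := by
      funext x
      simp only [u]
      rw [← Finset.prod_mul_distrib]
      refine Finset.prod_congr rfl fun t _ => ?_
      have hz : sole K i (x t) * sole K j (x t) = 0 := by
        rw [sole_eq_ite hi, sole_eq_ite hj]
        split_ifs with ha hb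
        · exact absurd (hb.2 i hi ha.1) hij
        all_goals norm_num
      linear_combination hz
    rw [e, designMean_prod p (fun _ r => 1 - sole K i r - sole K j r)]
    simp only [rowMean_sub, rowMean_const, rowMean_sole p hi, rowMean_sole p hj, ← hρ]
    rw [Finset.prod_const, Finset.card_univ, Fintype.card_fin, ← mul_pow]
    refine pow_le_pow_left₀ (by linarith) ?_ T
    nlinarith [sq_nonneg ρ]
  have hW2 : designMean p (fun x => (∑ i ∈ K, u i x) * ∑ j ∈ K, u j x) ≤ m + m * m := by
    have e : (fun x => (∑ i ∈ K, u i x) * ∑ j ∈ K, u j x) =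
        fun x => ∑ i ∈ K, ∑ j ∈ K, u i x * u j x := by
      funext x; rw [Finset.sum_mul_sum]
    rw [e, designMean_sum]
    have hi : ∀ i ∈ K, designMean p (fun x => ∑ j ∈ K, u i x * u j x) ≤
        (1 - ρ) ^ T + K.card * ((1 - ρ) ^ T * (1 - ρ) ^ T) := by
      intro i hi
      rw [designMean_sum, ← Finset.add_sum_erase K _ hi, huu i hi]
      gcongr
      calc _ ≤ ∑ j ∈ K.erase i, (1 - ρ) ^ T * (1 - ρ) ^ T :=
            Finset.sum_le_sum fun j hj => huv i hi j (Finset.mem_of_mem_erase hj)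
              (Finset.ne_of_mem_erase hj).symm
        _ ≤ ∑ j ∈ K, (1 - ρ) ^ T * (1 - ρ) ^ T :=
            Finset.sum_le_sum_of_subset_of_nonneg (Finset.erase_subset i K)
              fun _ _ _ => mul_self_nonneg _
        _ = _ := by simp
    calc _ ≤ ∑ i ∈ K, ((1 - ρ) ^ T + K.card * ((1 - ρ) ^ T * (1 - ρ) ^ T)) :=
          Finset.sum_le_sum hi
      _ = m + m * m := by rw [Finset.sum_const, nsmul_eq_mul, hm]; ring
  have hW : designMean p (fun x => ∑ i ∈ K, u i x) = m := by
    rw [designMean_sum, Finset.sum_congr rfl hu]; simp [hm]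
  -- Chebyshev: the indicator that the sum W vanishes is at most (W - m)² / m², and the variance is
  -- at most m.
  calc designMean p (fun x : Design T n => if definiteDefectives x (outcome x K) = K then 1 else 0)
      ≤ designMean p (fun x => (m ^ 2)⁻¹ * (((∑ i ∈ K, u i x) * ∑ j ∈ K, u j x) +
          ((-2 * m) * (∑ i ∈ K, u i x) + m ^ 2))) := by
        refine designMean_mono h0 h1 fun x => ?_
        have hsq : ((∑ i ∈ K, u i x) * ∑ j ∈ K, u j x) + ((-2 * m) * (∑ i ∈ K, u i x) + m ^ 2)
            = ((∑ i ∈ K, u i x) - m) ^ 2 := by ring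
        rw [hsq]
        split_ifs with h
        · have hz : ∑ i ∈ K, u i x = 0 := by
            refine Finset.sum_eq_zero fun i hi => ?_
            obtain ⟨t, ht⟩ := exists_sole_of_definiteDefectives_eq h hi
            exact Finset.prod_eq_zero (Finset.mem_univ t) (by rw [ht]; norm_num)
          rw [hz]
          field_simp
          norm_num
        · positivity
    _ ≤ (m ^ 2)⁻¹ * ((m + m * m) + (-2 * m * m + m ^ 2)) := by
        rw [designMean_const_mul, designMean_add, designMean_add, designMean_const_mul,
          designMean_const, hW]
        gcongr
    _ = 1 / m := by field_simp; ring

/-- A defective must be the only possible defective in some test: a first moment bound, given that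
at most `a` tests are negative. -/
lemma designMean_definiteDefectives_le {p : ℝ} (h0 : 0 ≤ p) (h1 : p ≤ 1)
    {K : Finset (Fin n)} (hK : K.Nonempty) (a : ℕ) {s : ℝ} (hs : 0 ≤ s) :
    designMean p (fun x : Design T n => if definiteDefectives x (outcome x K) = K then 1 else 0) ≤
      Real.exp (T * ((1 - p) ^ K.card * (Real.exp s - 1)) - s * a) +
        T * (p * (1 - p) ^ (K.card - 1)) * (1 - p * (1 - p) ^ a) ^ (n - K.card) := by
  classical
  -- One fixed defective is enough: it must be isolated in some test, and the union bound runs over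
  -- that test.
  obtain ⟨i, hi⟩ := hK
  let S : Design T n → Finset (Fin T) := fun x => Finset.univ.filter fun t => ∀ j ∈ K, x t j = false
  have hS : ∀ x, ∑ t, avoid K (x t) = (S x).card := by
    intro x
    simp only [S, avoid_eq_ite, Finset.card_filter]
    push_cast
    refine Finset.sum_congr rfl fun t _ => ?_
    have : (∃ i ∈ K, x t i = true) ↔ ¬ ∀ j ∈ K, x t j = false := by push Not; simp
    by_cases h : ∀ j ∈ K, x t j = false
    · rw [if_pos h, if_neg (by rw [this]; exact not_not.2 h)]
    · rw [if_neg h, if_pos (this.2 h)]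
  let f : Fin T → Design T n → ℝ := fun t x =>
    sole K i (x t) * if (S x).card ≤ a then 1 else 0
  -- The indicator that a nondefective with column `c` does not hide `i` in test `t`: it would do so
  -- by lying in `t` and in no negative test. Given the columns of `K`, these events are independent
  -- over the nondefectives.
  let g : Fin T → Design T n → (Fin T → Bool) → ℝ := fun t x c =>
    if c t = true ∧ ∀ t' ∈ S x, c t' = false then 0 else 1
  have hsole0 : ∀ r, 0 ≤ sole K i r := by
    intro r; rw [sole_eq_ite hi]; split_ifs <;> norm_num
  have hSK : ∀ x y : Design T n, (∀ t, ∀ i ∈ K, x t i = y t i) → S x = S y := by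
    intro x y h
    refine Finset.filter_congr fun t _ => ?_
    exact forall₂_congr fun j hj => by rw [h t j hj]
  have hterm : ∀ t, designMean p (fun x => f t x * ∏ j ∈ Kᶜ, g t x fun t' => x t' j) ≤
      p * (1 - p) ^ (K.card - 1) * (1 - p * (1 - p) ^ a) ^ (n - K.card) := by
    intro t
    have hcard : Kᶜ.card = n - K.card := by rw [Finset.card_compl, Fintype.card_fin]
    have hle := designMean_columns_le h0 h1 K (f t) (g t) (b := 1 - p * (1 - p) ^ a) ?_ ?_ ?_ ?_ ?_
    · rw [hcard] at hle
      refine hle.trans ?_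
      have hpa : p * (1 - p) ^ a ≤ 1 :=
        mul_le_one₀ h1 (pow_nonneg (by linarith) _) (pow_le_one₀ (by linarith) (by linarith))
      refine mul_le_mul_of_nonneg_right ?_ (pow_nonneg (by linarith) _)
      calc designMean p (f t) ≤ designMean p (fun x => ∏ t', if t' = t then sole K i (x t') else 1) := by
            refine designMean_mono h0 h1 fun x => ?_
            simp only [Finset.prod_ite_eq', Finset.mem_univ, if_true, f]
            have := hsole0 (x t)
            split_ifs <;> linarith
        _ = p * (1 - p) ^ (K.card - 1) := by
            rw [designMean_prod p (fun t' r => if t' = t then sole K i r else 1)]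
            have : ∀ t', rowMean p (fun r => if t' = t then sole K i r else 1) =
                if t' = t then p * (1 - p) ^ (K.card - 1) else 1 := by
              intro t'
              by_cases h : t' = t
              · simp only [h, if_true]; exact rowMean_sole p hi
              · simp only [h, if_false]; exact rowMean_const p 1
            simp_rw [this]
            simp
    · intro x y h
      simp only [f]
      rw [hSK x y h]
      congr 1
      rw [sole_eq_ite hi, sole_eq_ite hi]
      have he : (x t i = true ∧ ∀ j ∈ K, x t j = true → j = i) =
          (y t i = true ∧ ∀ j ∈ K, y t j = true → j = i) := by
        rw [h t i hi]
        refine congrArg _ (propext (forall₂_congr fun j hj => ?_))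
        rw [h t j hj]
      by_cases hy : y t i = true ∧ ∀ j ∈ K, y t j = true → j = i
      · rw [if_pos (he ▸ hy), if_pos hy]
      · rw [if_neg (he ▸ hy), if_neg hy]
    · intro x y h
      simp only [g]
      rw [hSK x y h]
    · intro x
      exact mul_nonneg (hsole0 _) (by split_ifs <;> norm_num)
    · intro x c
      simp only [g]
      split_ifs <;> norm_num
    · intro x hx
      have hS' : (S x).card ≤ a := by
        by_contra h
        exact hx (by simp [f, h])
      -- A test containing the defective `i` is positive, so lying in `t` is independent of avoiding
      -- the negative tests, and the hiding probability is exactly `p * (1 - p) ^ (S x).card`.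
      have htS : t ∉ S x := by
        intro ht
        refine hx ?_
        simp only [f]
        rw [sole_eq_ite hi, if_neg]
        · simp
        · rintro ⟨h, -⟩
          have := (Finset.mem_filter.1 ht).2 i hi
          simp [h] at this
      have e : g t x = fun c => 1 - (avoid (S x) c - avoid (insert t (S x)) c) := by
        funext c
        have hav : avoid (S x) c = if ∀ t' ∈ S x, c t' = false then 1 else 0 := by
          rw [avoid_eq_ite]
          have : (∃ t' ∈ S x, c t' = true) ↔ ¬ ∀ t' ∈ S x, c t' = false := by push Not; simp
          by_cases h : ∀ t' ∈ S x, c t' = false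
          · rw [if_pos h, if_neg (by rw [this]; exact not_not.2 h)]
          · rw [if_neg h, if_pos (this.2 h)]
        rw [avoid_insert htS, hav]
        simp only [g, ite_and]
        split_ifs <;> norm_num
      rw [e, rowMean_sub, rowMean_sub, rowMean_const, rowMean_avoid, rowMean_avoid,
        Finset.card_insert_of_notMem htS, pow_succ]
      have : (1 - p) ^ a ≤ (1 - p) ^ (S x).card :=
        pow_le_pow_of_le_one (by linarith) (by linarith) hS'
      nlinarith
  have hcher := designMean_chernoff (τ := Fin T) h0 h1 (avoid K)
    (fun r => by rw [avoid_eq_ite]; split_ifs <;> simp) s a (fun x => a < (S x).card)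
    (fun x hx => by rw [hS]; exact mul_le_mul_of_nonneg_left (by exact_mod_cast hx.le) hs)
  rw [rowMean_avoid, Fintype.card_fin] at hcher
  calc designMean p (fun x : Design T n => if definiteDefectives x (outcome x K) = K then 1 else 0)
      ≤ designMean p (fun x => (if a < (S x).card then 1 else 0) +
          ∑ t, f t x * ∏ j ∈ Kᶜ, g t x fun t' => x t' j) := by
        refine designMean_mono h0 h1 fun x => ?_
        have hnn : ∀ t, 0 ≤ f t x * ∏ j ∈ Kᶜ, g t x fun t' => x t' j := fun t =>
          mul_nonneg (mul_nonneg (hsole0 _) (by split_ifs <;> norm_num))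
            (Finset.prod_nonneg fun _ _ => by simp only [g]; split_ifs <;> norm_num)
        split_ifs with h hS'
        · linarith [Finset.sum_nonneg fun t (_ : t ∈ Finset.univ) => hnn t]
        · obtain ⟨t, ht, hu⟩ := exists_test_of_definiteDefectives_eq h hi
          rw [zero_add]
          refine le_trans (le_of_eq ?_) (Finset.single_le_sum (fun t _ => hnn t) (Finset.mem_univ t))
          have hf1 : f t x = 1 := by
            simp only [f]
            rw [sole_eq_ite hi, if_pos ⟨ht, fun j hj => hu j (subset_possibleDefectives x K hj)⟩,
              if_pos (not_lt.1 hS')]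
            norm_num
          rw [hf1, one_mul]
          symm
          refine Finset.prod_eq_one fun j hj => ?_
          simp only [g]
          rw [if_neg]
          rintro ⟨h2, h3⟩
          have hjK : j ∉ K := Finset.mem_compl.1 hj
          refine hjK ?_
          have hjp : j ∈ possibleDefectives x (outcome x K) := by
            simp only [possibleDefectives, Finset.mem_filter, Finset.mem_univ, true_and]
            intro t' ht'
            rw [outcome_eq_true]
            by_contra hno
            have : t' ∈ S x := by
              simp only [S, Finset.mem_filter, Finset.mem_univ, true_and]
              push Not at hno
              simpa using hno
            simp [h3 t' this] at ht'
          rw [hu j hjp h2]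
          exact hi
        · linarith [Finset.sum_nonneg fun t (_ : t ∈ Finset.univ) => hnn t]
        · linarith [Finset.sum_nonneg fun t (_ : t ∈ Finset.univ) => hnn t]
    _ ≤ _ := by
        rw [designMean_add, designMean_sum]
        refine add_le_add hcher ((Finset.sum_le_sum fun t _ => hterm t).trans (le_of_eq ?_))
        rw [Finset.sum_const, Finset.card_univ, Fintype.card_fin, nsmul_eq_mul]
        ring

end Converse

/-! ### Decoding by any set that explains the outcomes -/

open Classical in
/-- The algorithm that returns some set of `k` items explaining the test outcomes. -/
def anySatisfyingSet : DetectionAlgorithm := fun _ k _ x y =>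
  -- The default is never used on outcomes produced by a `k`-set, since that set itself explains
  -- them.
  if h : ∃ L : Finset _, L.card = k ∧ outcome x L = y then h.choose else ∅

section Satisfying

variable {T n : ℕ}

lemma exists_satisfying_of_anySatisfyingSet_ne {x : Design T n} {K : Finset (Fin n)}
    (h : anySatisfyingSet n K.card T x (outcome x K) ≠ K) :
    ∃ L : Finset (Fin n), L ≠ K ∧ L.card = K.card ∧ outcome x L = outcome x K := by
  have hex : ∃ L : Finset (Fin n), L.card = K.card ∧ outcome x L = outcome x K := ⟨K, rfl, rfl⟩
  rw [anySatisfyingSet, dif_pos hex] at h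
  exact ⟨_, h, hex.choose_spec⟩

lemma avoid_eq_zero_or_one (A : Finset (Fin n)) (r : Fin n → Bool) :
    avoid A r = 0 ∨ avoid A r = 1 := by
  rw [avoid_eq_ite]; split_ifs <;> simp

lemma avoid_eq_of_outcome_eq {x : Design T n} {K L : Finset (Fin n)}
    (h : outcome x L = outcome x K) (t : Fin T) : avoid L (x t) = avoid K (x t) := by
  classical
  rw [avoid_eq_ite, avoid_eq_ite]
  have := congrFun h t
  rw [Bool.eq_iff_iff, outcome_eq_true, outcome_eq_true] at this
  by_cases hK : ∃ i ∈ K, x t i = true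
  · rw [if_pos hK, if_pos (this.2 hK)]
  · rw [if_neg hK, if_neg fun h' => hK (this.1 h')]

/-- The difference is the indicator that a test meets `K`, and only inside `D`; being 0 or 1 makes
it fit for the Chernoff bound. -/
lemma avoid_sdiff_sub_avoid {D K : Finset (Fin n)} (hD : D ⊆ K) (r : Fin n → Bool) :
    avoid (K \ D) r - avoid K r = 0 ∨ avoid (K \ D) r - avoid K r = 1 := by
  have h : avoid K r = avoid (K \ D) r * avoid D r := by
    rw [avoid_mul_avoid Finset.sdiff_disjoint, Finset.sdiff_union_of_subset hD]
  rw [h]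
  rcases avoid_eq_zero_or_one (K \ D) r with h1 | h1 <;>
    rcases avoid_eq_zero_or_one D r with h2 | h2 <;> simp [h1, h2]

/-- The probability that exchanging the defectives in `D` for the nondefectives in `J` explains the
outcomes, when at least `a` tests are negative and at least `b` tests meet `K` only in `D`. -/
lemma designMean_exchange_le {p : ℝ} (h0 : 0 < p) (h1 : p < 1) {K D J : Finset (Fin n)}
    (hD : D ⊆ K) (hJ : Disjoint J K) (hDJ : J.card = D.card) (hD0 : D.Nonempty) (a b : ℝ)
    (P : Design T n → Prop) [DecidablePred P]
    (hP : ∀ x, P x → outcome x (K \ D ∪ J) = outcome x K ∧ a ≤ ∑ t, avoid K (x t) ∧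
      b ≤ ∑ t, (avoid (K \ D) (x t) - avoid K (x t))) :
    designMean p (fun x : Design T n => if P x then 1 else 0) ≤
      (1 - p) ^ (D.card * a) * (1 - (1 - p) ^ D.card) ^ b := by
  have hq0 : 0 < 1 - p := by linarith
  set α : ℝ := (1 - p) ^ D.card with hα
  have hα0 : 0 < α := pow_pos hq0 _
  have hα1 : α < 1 := pow_lt_one₀ hq0.le (by linarith) hD0.card_pos.ne'
  have hβ0 : 0 < 1 - α := by linarith
  have hKD : ∀ r : Fin n → Bool, avoid K r = avoid (K \ D) r * avoid D r := fun r => by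
    rw [avoid_mul_avoid Finset.sdiff_disjoint, Finset.sdiff_union_of_subset hD]
  have hJKD : Disjoint (K \ D) J := (hJ.mono_right Finset.sdiff_subset).symm
  have hJD : Disjoint D J := (hJ.mono_right hD).symm
  -- A change of measure of mean 1. The exchange requires `J` to be avoided in a negative test
  -- (conditional probability `α`) and hit in a test meeting `K` only in `D` (conditional
  -- probability `1 - α`), and nothing elsewhere. `F` is the indicator of the requirement divided by
  -- its conditional probability, so Markov's inequality for the product over the tests gives the
  -- bound.
  let F : (Fin n → Bool) → ℝ := fun r =>
    α⁻¹ * (avoid K r * avoid J r) +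
      ((1 - α)⁻¹ * (avoid (K \ D) r * (1 - avoid D r) * (1 - avoid J r)) + (1 - avoid (K \ D) r))
  have hF0 : ∀ r, 0 ≤ F r := by
    intro r
    have hpos1 : 0 ≤ α⁻¹ := by positivity
    have hpos2 : 0 ≤ (1 - α)⁻¹ := by positivity
    simp only [F, hKD]
    rcases avoid_eq_zero_or_one (K \ D) r with e1 | e1 <;>
    rcases avoid_eq_zero_or_one D r with e2 | e2 <;>
    rcases avoid_eq_zero_or_one J r with e3 | e3 <;> simp [e1, e2, e3, hα1.le, hα0.le]
  have hFm : rowMean p F = 1 := by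
    have e : F = fun r => α⁻¹ * avoid (K ∪ J) r + ((1 - α)⁻¹ * (avoid (K \ D) r - avoid K r -
        (avoid (K \ D ∪ J) r - avoid (K ∪ J) r)) + (1 - avoid (K \ D) r)) := by
      funext r
      simp only [F]
      rw [← avoid_mul_avoid hJ.symm, ← avoid_mul_avoid hJKD, hKD]
      ring
    have hk : K.card = (K \ D).card + D.card := by
      rw [Finset.card_sdiff_of_subset hD, Nat.sub_add_cancel (Finset.card_le_card hD)]
    rw [e]
    simp only [rowMean_add, rowMean_sub, rowMean_const_mul, rowMean_const, rowMean_avoid]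
    rw [Finset.card_union_of_disjoint hJ.symm, Finset.card_union_of_disjoint hJKD, hDJ, hk]
    simp only [pow_add]
    rw [← hα]
    field_simp
    ring
  have hprod : ∀ x, P x → (1 : ℝ) ≤ α ^ a * (1 - α) ^ b * ∏ t, F (x t) := by
    intro x hx
    obtain ⟨hsat, ha, hb⟩ := hP x hx
    have hrow : ∀ t, F (x t) = (α⁻¹) ^ avoid K (x t) *
        ((1 - α)⁻¹) ^ (avoid (K \ D) (x t) - avoid K (x t)) := by
      intro t
      have hs := avoid_eq_of_outcome_eq hsat t
      rw [← avoid_mul_avoid hJKD, hKD] at hs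
      simp only [F, hKD]
      rcases avoid_eq_zero_or_one (K \ D) (x t) with e1 | e1 <;>
      rcases avoid_eq_zero_or_one D (x t) with e2 | e2 <;>
      rcases avoid_eq_zero_or_one J (x t) with e3 | e3 <;> simp [e1, e2, e3] at hs ⊢
    have hFx : ∏ t, F (x t) = (α⁻¹) ^ (∑ t, avoid K (x t)) *
        ((1 - α)⁻¹) ^ (∑ t, (avoid (K \ D) (x t) - avoid K (x t))) := by
      rw [Finset.prod_congr rfl fun t _ => hrow t, Finset.prod_mul_distrib,
        Real.rpow_sum_of_pos (by positivity), Real.rpow_sum_of_pos (by positivity)]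
    have hA : (α⁻¹) ^ a ≤ (α⁻¹) ^ (∑ t, avoid K (x t)) :=
      Real.rpow_le_rpow_of_exponent_le ((one_le_inv₀ hα0).2 hα1.le) ha
    have hB : ((1 - α)⁻¹) ^ b ≤ ((1 - α)⁻¹) ^ (∑ t, (avoid (K \ D) (x t) - avoid K (x t))) :=
      Real.rpow_le_rpow_of_exponent_le ((one_le_inv₀ hβ0).2 (by linarith)) hb
    have hAa : α ^ a * (α⁻¹) ^ a = 1 := by
      rw [← Real.mul_rpow hα0.le (by positivity), mul_inv_cancel₀ hα0.ne', Real.one_rpow]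
    have hBb : (1 - α) ^ b * ((1 - α)⁻¹) ^ b = 1 := by
      rw [← Real.mul_rpow hβ0.le (by positivity), mul_inv_cancel₀ hβ0.ne', Real.one_rpow]
    rw [hFx]
    calc (1 : ℝ) = (α ^ a * (1 - α) ^ b) * ((α⁻¹) ^ a * ((1 - α)⁻¹) ^ b) := by
          rw [mul_mul_mul_comm, hAa, hBb, one_mul]
      _ ≤ _ := by gcongr
  have hαa : α ^ a = (1 - p) ^ (D.card * a) := by
    rw [hα, ← Real.rpow_natCast, ← Real.rpow_mul hq0.le]
  rw [← hαa]
  calc designMean p (fun x : Design T n => if P x then 1 else 0)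
      ≤ designMean p (fun x => α ^ a * (1 - α) ^ b * ∏ t, F (x t)) := by
        refine designMean_mono h0.le h1.le fun x => ?_
        split_ifs with h
        · exact hprod x h
        · exact mul_nonneg (by positivity) (Finset.prod_nonneg fun t _ => hF0 _)
    _ = α ^ a * (1 - α) ^ b := by
        rw [designMean_const_mul, designMean_prod p (fun _ r => F r), hFm]
        simp

open Classical in
/-- The probability that a set of the size of `K` other than `K` explains the outcomes. The
parameters `a` and `b l` are the thresholds for the numbers of negative tests and of tests meeting
`K` only in a given subset of size `l`. -/
lemma designMean_satisfying_le {p : ℝ} (h0 : 0 < p) (h1 : p < 1) (K : Finset (Fin n))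
    (a : ℝ) (b : ℕ → ℝ) {s s' : ℝ} (hs : 0 ≤ s) (hs' : 0 ≤ s') :
    designMean p (fun x : Design T n =>
      if ∃ L : Finset (Fin n), L ≠ K ∧ L.card = K.card ∧ outcome x L = outcome x K
        then 1 else 0) ≤
      Real.exp (s * a - T * ((1 - p) ^ K.card * (1 - Real.exp (-s)))) +
      ∑ l ∈ Finset.Icc 1 K.card, K.card.choose l *
        (Real.exp (s' * b l -
          T * (((1 - p) ^ (K.card - l) - (1 - p) ^ K.card) * (1 - Real.exp (-s')))) +
        (n - K.card).choose l * ((1 - p) ^ (l * a) * (1 - (1 - p) ^ l) ^ b l)) := by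
  let N0 : Design T n → ℝ := fun x => ∑ t, avoid K (x t)
  let N : Finset (Fin n) → Design T n → ℝ := fun D x => ∑ t, (avoid (K \ D) (x t) - avoid K (x t))
  let E : Finset (Fin n) → Finset (Fin n) → Design T n → Prop := fun D J x =>
    outcome x (K \ D ∪ J) = outcome x K ∧ a ≤ N0 x ∧ b D.card ≤ N D x
  have hA : designMean p (fun x : Design T n => if N0 x < a then 1 else 0) ≤
      Real.exp (s * a - T * ((1 - p) ^ K.card * (1 - Real.exp (-s)))) := by
    have := designMean_chernoff (τ := Fin T) h0.le h1.le (avoid K) (avoid_eq_zero_or_one K) (-s) a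
      (fun x => N0 x < a) (fun x hx => by
        have := mul_le_mul_of_nonneg_left hx.le hs
        simp only [N0] at this
        linarith)
    rw [rowMean_avoid, Fintype.card_fin] at this
    refine this.trans (le_of_eq ?_)
    congr 1; ring
  have hB : ∀ l, ∀ D ∈ Finset.powersetCard l K,
      designMean p (fun x : Design T n => if N D x < b l then 1 else 0) ≤
      Real.exp (s' * b l -
        T * (((1 - p) ^ (K.card - l) - (1 - p) ^ K.card) * (1 - Real.exp (-s')))) := by
    intro l D hD
    rw [Finset.mem_powersetCard] at hD
    have := designMean_chernoff (τ := Fin T) h0.le h1.le (fun r => avoid (K \ D) r - avoid K r)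
      (avoid_sdiff_sub_avoid hD.1) (-s') (b l) (fun x => N D x < b l) (fun x hx => by
        have := mul_le_mul_of_nonneg_left hx.le hs'
        simp only [N] at this
        linarith)
    rw [rowMean_sub, rowMean_avoid, rowMean_avoid, Fintype.card_fin,
      Finset.card_sdiff_of_subset hD.1, hD.2] at this
    refine this.trans (le_of_eq ?_)
    congr 1; ring
  have hC : ∀ l, 1 ≤ l → ∀ D ∈ Finset.powersetCard l K, ∀ J ∈ Finset.powersetCard l Kᶜ,
      designMean p (fun x : Design T n => if E D J x then 1 else 0) ≤
        (1 - p) ^ (l * a) * (1 - (1 - p) ^ l) ^ b l := by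
    intro l hl D hD J hJ
    rw [Finset.mem_powersetCard] at hD hJ
    obtain ⟨hDK, rfl⟩ := hD
    exact designMean_exchange_le (T := T) h0 h1 hDK
      (Finset.disjoint_left.2 fun i hi => Finset.mem_compl.1 (hJ.1 hi)) hJ.2
      (Finset.card_pos.1 (by omega)) a (b D.card) (E D J) (fun x hx => hx)
  -- A wrong set `L` is coded by `D = K \ L` and `J = L \ K`, of equal size. The failure of the
  -- threshold for `D` is charged before summing over `J`, so it pays only for the choice of `D`.
  calc _ ≤ designMean p (fun x : Design T n => (if N0 x < a then 1 else 0) +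
        ∑ l ∈ Finset.Icc 1 K.card, ∑ D ∈ Finset.powersetCard l K,
          ((if N D x < b l then 1 else 0) +
            ∑ J ∈ Finset.powersetCard l Kᶜ, if E D J x then 1 else 0)) := by
        refine designMean_mono h0.le h1.le fun x => ?_
        have hJ0 : ∀ l D, (0 : ℝ) ≤ ∑ J ∈ Finset.powersetCard l Kᶜ, if E D J x then (1 : ℝ) else 0 :=
          fun l D => Finset.sum_nonneg fun J _ => by split_ifs <;> norm_num
        have hD0 : ∀ l D, (0 : ℝ) ≤ (if N D x < b l then (1 : ℝ) else 0) +
            ∑ J ∈ Finset.powersetCard l Kᶜ, if E D J x then (1 : ℝ) else 0 :=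
          fun l D => add_nonneg (by split_ifs <;> norm_num) (hJ0 l D)
        have hl0 : ∀ l, (0 : ℝ) ≤ ∑ D ∈ Finset.powersetCard l K,
            ((if N D x < b l then (1 : ℝ) else 0) +
            ∑ J ∈ Finset.powersetCard l Kᶜ, if E D J x then (1 : ℝ) else 0) :=
          fun l => Finset.sum_nonneg fun D _ => hD0 l D
        have hs0 := Finset.sum_nonneg fun l (_ : l ∈ Finset.Icc 1 K.card) => hl0 l
        by_cases h : ∃ L : Finset (Fin n), L ≠ K ∧ L.card = K.card ∧ outcome x L = outcome x K
        · rw [if_pos h]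
          by_cases hN : N0 x < a
          · rw [if_pos hN]; linarith
          · rw [if_neg hN, zero_add]
            obtain ⟨L, hLK, hcard, hout⟩ := h
            have hc : (L \ K).card = (K \ L).card := Finset.card_sdiff_comm hcard
            have hne : (K \ L).Nonempty := by
              rw [Finset.sdiff_nonempty]
              exact fun hsub => hLK (Finset.eq_of_subset_of_card_le hsub hcard.le).symm
            have hmem : (K \ L).card ∈ Finset.Icc 1 K.card :=
              Finset.mem_Icc.2 ⟨hne.card_pos, Finset.card_le_card Finset.sdiff_subset⟩
            have hDm : K \ L ∈ Finset.powersetCard (K \ L).card K :=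
              Finset.mem_powersetCard.2 ⟨Finset.sdiff_subset, rfl⟩
            have hJm : L \ K ∈ Finset.powersetCard (K \ L).card Kᶜ :=
              Finset.mem_powersetCard.2
                ⟨fun i hi => Finset.mem_compl.2 (Finset.mem_sdiff.1 hi).2, hc⟩
            refine le_trans ?_ (Finset.single_le_sum (fun l _ => hl0 l) hmem)
            refine le_trans ?_ (Finset.single_le_sum (fun D _ => hD0 _ D) hDm)
            by_cases hb : N (K \ L) x < b (K \ L).card
            · rw [if_pos hb]; linarith [hJ0 (K \ L).card (K \ L)]
            · rw [if_neg hb, zero_add]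
              have hE : E (K \ L) (L \ K) x := by
                refine ⟨?_, not_lt.1 hN, not_lt.1 hb⟩
                have : K \ (K \ L) ∪ L \ K = L := by
                  ext i
                  simp only [Finset.mem_union, Finset.mem_sdiff]
                  tauto
                rw [this, hout]
              refine le_trans ?_ (Finset.single_le_sum (fun J _ => ?_) hJm)
              · rw [if_pos hE]
              · split_ifs <;> norm_num
        · rw [if_neg h]
          have : (0 : ℝ) ≤ if N0 x < a then 1 else 0 := by split_ifs <;> norm_num
          linarith
    _ ≤ _ := by
        rw [designMean_add, designMean_sum]
        refine add_le_add hA (Finset.sum_le_sum fun l hl => ?_)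
        rw [designMean_sum, ← nsmul_eq_mul, ← Finset.card_powersetCard l K]
        refine Finset.sum_le_card_nsmul _ _ _ fun D hD => ?_
        rw [designMean_add, designMean_sum]
        refine add_le_add (hB l D hD) ?_
        have hcc : (n - K.card).choose l = (Finset.powersetCard l Kᶜ).card := by
          rw [Finset.card_powersetCard, Finset.card_compl, Fintype.card_fin]
        rw [hcc, ← nsmul_eq_mul]
        exact Finset.sum_le_card_nsmul _ _ _ fun J hJ => hC l (Finset.mem_Icc.1 hl).1 D hD J hJ

end Satisfying

/-! ### From a fixed defective set to the average error -/

section ErrorProbability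

open Classical in
lemma errorProbability_eq (A : DetectionAlgorithm) (n k T : ℕ) (p : unitInterval) :
    errorProbability A n k T p = (1 / (n.choose k : ℝ)) *
      ∑ K ∈ Finset.powersetCard k (Finset.univ : Finset (Fin n)),
        designMean (p : ℝ) (fun x : Design T n => if A n k T x (outcome x K) ≠ K then 1 else 0) := by
  simp only [errorProbability, bernoulliDesign_real]
  refine congrArg _ (Finset.sum_congr rfl fun K _ => congrArg _ (funext fun x => ?_))
  by_cases h : A n k T x (outcome x K) = K <;> simp [h]

open Classical in
lemma errorProbability_le {A : DetectionAlgorithm} {n k T : ℕ} {p : unitInterval} {b : ℝ}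
    (hkn : k ≤ n)
    (h : ∀ K : Finset (Fin n), K.card = k →
      designMean (p : ℝ) (fun x : Design T n => if A n k T x (outcome x K) ≠ K then 1 else 0) ≤ b) :
    errorProbability A n k T p ≤ b := by
  have hc : (0 : ℝ) < n.choose k := by exact_mod_cast Nat.choose_pos hkn
  rw [errorProbability_eq, one_div, inv_mul_le_iff₀ hc]
  have := Finset.sum_le_card_nsmul (Finset.powersetCard k (Finset.univ : Finset (Fin n))) _ b
    fun K hK => h K (Finset.mem_powersetCard.1 hK).2
  simpa using this

open Classical in
lemma le_errorProbability {A : DetectionAlgorithm} {n k T : ℕ} {p : unitInterval} {b : ℝ}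
    (hkn : k ≤ n)
    (h : ∀ K : Finset (Fin n), K.card = k →
      designMean (p : ℝ) (fun x : Design T n => if A n k T x (outcome x K) = K then 1 else 0) ≤ b) :
    1 - b ≤ errorProbability A n k T p := by
  have hc : (0 : ℝ) < n.choose k := by exact_mod_cast Nat.choose_pos hkn
  rw [errorProbability_eq, one_div, le_inv_mul_iff₀ hc]
  have := Finset.card_nsmul_le_sum (Finset.powersetCard k (Finset.univ : Finset (Fin n)))
    (fun K => designMean (p : ℝ)
      (fun x : Design T n => if A n k T x (outcome x K) ≠ K then 1 else 0)) (1 - b)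
    fun K hK => by
      have h1 := h K (Finset.mem_powersetCard.1 hK).2
      have h2 := designMean_add (p : ℝ)
        (fun x : Design T n => if A n k T x (outcome x K) = K then 1 else 0)
        (fun x : Design T n => if A n k T x (outcome x K) ≠ K then 1 else 0)
      have h3 : (fun x : Design T n => (if A n k T x (outcome x K) = K then (1 : ℝ) else 0) +
          if A n k T x (outcome x K) ≠ K then 1 else 0) = fun _ => 1 := by
        funext x
        by_cases h : A n k T x (outcome x K) = K <;> simp [h]
      rw [h3, designMean_const] at h2
      linarith
  simpa using this

end ErrorProbability

/-! ### Asymptotics of `k n` and of the binomial coefficient -/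

section Growth

lemma tendsto_log_natCast : Tendsto (fun n : ℕ => Real.log n) atTop atTop :=
  Real.tendsto_log_atTop.comp tendsto_natCast_atTop_atTop

variable {θ : ℝ} {k : ℕ → ℕ}

/-- The growth condition `k n = Θ(n^θ)`, in terms of `log n`. -/
lemma exists_growth_bounds
    (hk : (fun n : ℕ => (k n : ℝ)) =Θ[atTop] fun n : ℕ => (n : ℝ) ^ θ) :
    ∃ A B : ℝ, 0 < A ∧ 0 < B ∧ ∀ᶠ n : ℕ in atTop,
      A * Real.exp (θ * Real.log n) ≤ k n ∧ (k n : ℝ) ≤ B * Real.exp (θ * Real.log n) := by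
  obtain ⟨B, hB, h1⟩ := hk.1.exists_pos
  obtain ⟨A, hA, h2⟩ := hk.2.exists_pos
  refine ⟨A⁻¹, B, inv_pos.2 hA, hB, ?_⟩
  filter_upwards [h1.bound, h2.bound, eventually_gt_atTop 0] with n h1 h2 hn
  have hn' : (0 : ℝ) < n := by exact_mod_cast hn
  have e : (n : ℝ) ^ θ = Real.exp (θ * Real.log n) := by
    rw [Real.rpow_def_of_pos hn', mul_comm]
  rw [e, Real.norm_of_nonneg (Nat.cast_nonneg _), Real.norm_of_nonneg (Real.exp_pos _).le] at h1 h2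
  exact ⟨by rwa [inv_mul_le_iff₀ hA], h1⟩

lemma tendsto_const_mul_exp_log {a c : ℝ} (ha : 0 < a) (hc : 0 < c) :
    Tendsto (fun n : ℕ => a * Real.exp (c * Real.log n)) atTop atTop :=
  (Real.tendsto_exp_atTop.comp (tendsto_log_natCast.const_mul_atTop hc)).const_mul_atTop ha

lemma tendsto_defectives (hθ0 : 0 < θ)
    (hk : (fun n : ℕ => (k n : ℝ)) =Θ[atTop] fun n : ℕ => (n : ℝ) ^ θ) :
    Tendsto k atTop atTop := by
  obtain ⟨A, B, hA, -, h⟩ := exists_growth_bounds hk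
  have : Tendsto (fun n => (k n : ℝ)) atTop atTop :=
    tendsto_atTop_mono' _ (h.mono fun n hn => hn.1) (tendsto_const_mul_exp_log hA hθ0)
  exact tendsto_natCast_atTop_iff.1 this

lemma eventually_two_mul_defectives_le (hθ1 : θ < 1)
    (hk : (fun n : ℕ => (k n : ℝ)) =Θ[atTop] fun n : ℕ => (n : ℝ) ^ θ) :
    ∀ᶠ n in atTop, 2 * k n ≤ n := by
  obtain ⟨A, B, -, hB, h⟩ := exists_growth_bounds hk
  have h2 := (tendsto_const_mul_exp_log (a := (2 * B)⁻¹) (by positivity)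
    (sub_pos.2 hθ1)).eventually_ge_atTop 1
  filter_upwards [h, h2, eventually_gt_atTop 0] with n h1 h2 hn
  have hn' : (0 : ℝ) < n := by exact_mod_cast hn
  have e : Real.exp ((1 - θ) * Real.log n) * Real.exp (θ * Real.log n) = n := by
    rw [← Real.exp_add, ← add_mul, sub_add_cancel, one_mul, Real.exp_log hn']
  have h3 : 2 * B ≤ Real.exp ((1 - θ) * Real.log n) := by
    have := (le_inv_mul_iff₀ (by positivity : 0 < 2 * B)).1 h2
    linarith
  have : (2 : ℝ) * k n ≤ n := by
    calc (2 : ℝ) * k n ≤ 2 * B * Real.exp (θ * Real.log n) := by linarith [h1.2]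
      _ ≤ Real.exp ((1 - θ) * Real.log n) * Real.exp (θ * Real.log n) := by gcongr
      _ = n := e
  exact_mod_cast this

/-- `n.choose k ≤ (e n / k) ^ k`. -/
lemma choose_le_exp_mul_div_pow (n : ℕ) {l : ℕ} (hl : 0 < l) :
    (n.choose l : ℝ) ≤ (Real.exp 1 * n / l) ^ l := by
  have hl' : (0 : ℝ) < l := by exact_mod_cast hl
  have h1 := Nat.choose_le_pow_div (α := ℝ) l n
  have h2 := Real.pow_div_factorial_le_exp (x := (l : ℝ)) hl'.le l
  have hf : (0 : ℝ) < l.factorial := by exact_mod_cast l.factorial_pos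
  rw [div_le_iff₀ hf] at h2
  refine h1.trans ?_
  rw [div_pow, mul_pow, div_le_div_iff₀ hf (by positivity), ← Real.exp_nat_mul, mul_one]
  calc (n : ℝ) ^ l * (l : ℝ) ^ l ≤ (n : ℝ) ^ l * (Real.exp l * l.factorial) := by gcongr
    _ = _ := by ring

/-- `(n / (2 k)) ^ k ≤ n.choose k` when `2 k ≤ n`. -/
lemma div_pow_le_choose {n l : ℕ} (hl : 0 < l) (hln : 2 * l ≤ n) :
    ((n : ℝ) / (2 * l)) ^ l ≤ n.choose l := by
  have h1 := Nat.pow_sub_le_descFactorial n l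
  rw [Nat.descFactorial_eq_factorial_mul_choose] at h1
  have h2 : ((n : ℝ) / 2) ^ l ≤ l.factorial * n.choose l := by
    have : ((n + 1 - l : ℕ) : ℝ) ^ l ≤ l.factorial * n.choose l := by exact_mod_cast h1
    refine le_trans (pow_le_pow_left₀ (by positivity) ?_ l) this
    have h3 : n ≤ 2 * (n + 1 - l) := by omega
    have h4 : (n : ℝ) ≤ 2 * ((n + 1 - l : ℕ) : ℝ) := by exact_mod_cast h3
    linarith
  have h3 : (l.factorial : ℝ) ≤ (l : ℝ) ^ l := by exact_mod_cast l.factorial_le_pow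
  have hl' : (0 : ℝ) < (l : ℝ) ^ l := by positivity
  rw [← div_div, div_pow, div_le_iff₀ hl']
  calc _ ≤ (l.factorial : ℝ) * n.choose l := h2
    _ ≤ (l : ℝ) ^ l * n.choose l := by gcongr
    _ = _ := mul_comm _ _

/-- The ratio n / k is of order n^(1 - θ), so the constants of the growth condition and of the
binomial bound cost only O(1) per defective. -/
lemma exists_log_choose_le
    (hk : (fun n : ℕ => (k n : ℝ)) =Θ[atTop] fun n : ℕ => (n : ℝ) ^ θ) :
    ∃ C : ℝ, ∀ᶠ n : ℕ in atTop, 0 < k n → k n ≤ n →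
      Real.log (n.choose (k n)) ≤ k n * ((1 - θ) * Real.log n + C) := by
  obtain ⟨A, B, hA, -, h⟩ := exists_growth_bounds hk
  refine ⟨1 - Real.log A, ?_⟩
  filter_upwards [h, eventually_gt_atTop 0] with n h hn hk0 hkn
  have hn' : (0 : ℝ) < n := by exact_mod_cast hn
  have hk' : (0 : ℝ) < k n := by exact_mod_cast hk0
  have hc : (0 : ℝ) < n.choose (k n) := by exact_mod_cast Nat.choose_pos hkn
  have h1 := Real.log_le_log hc (choose_le_exp_mul_div_pow n hk0)
  rw [Real.log_pow, Real.log_div (by positivity) hk'.ne', Real.log_mul (Real.exp_pos 1).ne' hn'.ne',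
    Real.log_exp] at h1
  have h2 := Real.log_le_log (by positivity) h.1
  rw [Real.log_mul hA.ne' (Real.exp_pos _).ne', Real.log_exp] at h2
  refine h1.trans (mul_le_mul_of_nonneg_left ?_ hk'.le)
  linarith

lemma exists_le_log_choose (hθ0 : 0 < θ) (hθ1 : θ < 1)
    (hk : (fun n : ℕ => (k n : ℝ)) =Θ[atTop] fun n : ℕ => (n : ℝ) ^ θ) :
    ∃ C : ℝ, ∀ᶠ n : ℕ in atTop,
      k n * ((1 - θ) * Real.log n - C) ≤ Real.log (n.choose (k n)) := by
  obtain ⟨A, B, -, hB, h⟩ := exists_growth_bounds hk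
  refine ⟨Real.log 2 + Real.log B, ?_⟩
  filter_upwards [h, eventually_gt_atTop 0, eventually_two_mul_defectives_le hθ1 hk,
    (tendsto_defectives hθ0 hk).eventually_gt_atTop 0] with n h hn h2k hk0
  have hn' : (0 : ℝ) < n := by exact_mod_cast hn
  have hk' : (0 : ℝ) < k n := by exact_mod_cast hk0
  have h1 := Real.log_le_log (by positivity) (div_pow_le_choose hk0 h2k)
  rw [Real.log_pow, Real.log_div (by positivity) (by positivity),
    Real.log_mul (by norm_num) hk'.ne'] at h1
  have h2 := Real.log_le_log hk' h.2
  rw [Real.log_mul hB.ne' (Real.exp_pos _).ne', Real.log_exp] at h2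
  refine le_trans (mul_le_mul_of_nonneg_left ?_ hk'.le) h1
  linarith

end Growth

/-! ### Upper bound on the rate of DD -/

section Converse

variable {θ : ℝ} {k : ℕ → ℕ}

/-- The probability that a given defective is the only one in a test is at most `1 / (e (k - 1))`. -/
lemma sole_probability_le {p : ℝ} (h1 : p ≤ 1) {k : ℕ} (hk : 1 ≤ k) :
    p * (1 - p) ^ (k - 1) * (k - 1) ≤ Real.exp (-1) := by
  have hcast : ((k - 1 : ℕ) : ℝ) = k - 1 := by push_cast [hk]; ring
  have hk' : (0 : ℝ) ≤ (k : ℝ) - 1 := by rw [← hcast]; positivity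
  have h2 : (1 - p) ^ (k - 1) ≤ Real.exp (-(p * (k - 1))) := by
    calc (1 - p) ^ (k - 1) ≤ Real.exp (-p) ^ (k - 1) :=
          pow_le_pow_left₀ (by linarith) (Real.one_sub_le_exp_neg p) _
      _ = _ := by rw [← Real.exp_nat_mul, hcast]; congr 1; ring
  -- The tangent bound x ≤ e^(x - 1) at x = p (k - 1), with equality at x = 1, is the source of the
  -- factor 1 / e.
  have h3 : p * (k - 1) ≤ Real.exp (p * (k - 1) - 1) := by
    have := Real.add_one_le_exp (p * ((k : ℝ) - 1) - 1); linarith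
  calc p * (1 - p) ^ (k - 1) * (k - 1) = p * (k - 1) * (1 - p) ^ (k - 1) := by ring
    _ ≤ Real.exp (p * (k - 1) - 1) * Real.exp (-(p * (k - 1))) := by gcongr
    _ = Real.exp (-1) := by rw [← Real.exp_add]; congr 1; ring

/-- From log y ≥ 1 - 1 / y at y = 1 - x. Keeping the exact denominator 1 - x lets it cancel against
a factor 1 - p later. -/
lemma exp_neg_le_one_sub_pow {x : ℝ} (hx : x < 1) (m : ℕ) :
    Real.exp (-(m * (x / (1 - x)))) ≤ (1 - x) ^ m := by
  have h := Real.one_sub_inv_le_log_of_pos (sub_pos.2 hx)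
  have h2 : 1 - (1 - x)⁻¹ = -(x / (1 - x)) := by
    have : 1 - x ≠ 0 := by linarith
    field_simp; ring
  rw [h2] at h
  calc Real.exp (-(m * (x / (1 - x)))) = Real.exp (-(x / (1 - x))) ^ m := by
        rw [← Real.exp_nat_mul]; congr 1; ring
    _ ≤ Real.exp (Real.log (1 - x)) ^ m := by gcongr
    _ = _ := by rw [Real.exp_log (sub_pos.2 hx)]

lemma one_sub_pow_le_one_div {z y : ℝ} {m : ℕ} (hz : z ≤ 1) (hy : 0 < y) (h : y ≤ m * z) :
    (1 - z) ^ m ≤ 1 / y := by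
  calc (1 - z) ^ m ≤ Real.exp (-z) ^ m :=
        pow_le_pow_left₀ (by linarith) (Real.one_sub_le_exp_neg _) _
    _ = Real.exp (-(m * z)) := by rw [← Real.exp_nat_mul]; congr 1; ring
    _ ≤ Real.exp (-y) := Real.exp_le_exp.2 (neg_le_neg h)
    _ ≤ 1 / y := by
        rw [Real.exp_neg, ← one_div]
        exact one_div_le_one_div_of_le hy (by linarith [Real.add_one_le_exp y])

/-- Some defective is never the only defective in a test when there are too few tests. -/
lemma eventually_definiteDefectives_le_of_lt (hθ0 : 0 < θ)
    (hk : (fun n : ℕ => (k n : ℝ)) =Θ[atTop] fun n : ℕ => (n : ℝ) ^ θ)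
    {v : ℝ} (hv0 : 0 < v) (hv : v < θ) :
    ∀ᶠ n : ℕ in atTop, ∀ (p : ℝ) (T : ℕ) (K : Finset (Fin n)), 0 ≤ p → p ≤ 1 → K.card = k n →
      T * (p * (1 - p) ^ (k n - 1)) ≤ v * Real.log n →
      designMean p (fun x : Design T n => if definiteDefectives x (outcome x K) = K then 1 else 0)
        ≤ 1 / 4 := by
  obtain ⟨A, B, hA, -, hAB⟩ := exists_growth_bounds hk
  -- The room between `v` and `v'` absorbs the denominator 1 - ρ, and the room between `v'` and `θ`
  -- makes k n^(-v') diverge.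
  set v' := (v + θ) / 2 with hv'
  have hvv' : v < v' := by rw [hv']; linarith
  have hv'θ : v' < θ := by rw [hv']; linarith
  have hη : 0 < 1 - v / v' := by
    rw [sub_pos, div_lt_one (by linarith)]; exact hvv'
  have e1 := (tendsto_natCast_atTop_atTop (R := ℝ)).comp (tendsto_defectives hθ0 hk)
  filter_upwards [hAB, (tendsto_const_mul_exp_log hA (sub_pos.2 hv'θ)).eventually_ge_atTop 4,
    e1.eventually_ge_atTop (3 + (1 - v / v')⁻¹), tendsto_log_natCast.eventually_ge_atTop 0]
    with n hAB h4 hkn hL p T K h0 h1 hK hT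
  simp only [Function.comp] at hkn
  have hinv : 0 < (1 - v / v')⁻¹ := inv_pos.2 hη
  have hk1 : 1 ≤ k n := by
    have : (1 : ℝ) ≤ k n := by linarith
    exact_mod_cast this
  set ρ := p * (1 - p) ^ (k n - 1) with hρ
  have hρ0 : 0 ≤ ρ := mul_nonneg h0 (pow_nonneg (by linarith) _)
  have hρk : ρ * (k n - 1) ≤ 1 :=
    (sole_probability_le h1 hk1).trans (Real.exp_le_one_iff.2 (by norm_num))
  have hρ2 : ρ ≤ 1 / 2 := by nlinarith
  have hρη : ρ ≤ 1 - v / v' := by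
    have h5 : ρ * (1 - v / v')⁻¹ ≤ 1 := by nlinarith
    rwa [← div_eq_mul_inv, div_le_one hη] at h5
  have hKne : K.Nonempty := by rw [← Finset.card_pos]; omega
  have hbound := designMean_definiteDefectives_le_inv (T := T) h0 h1 hKne
    (ρ := ρ) (by rw [hK]) hρ2
  refine hbound.trans ?_
  rw [hK]
  have hlow : Real.exp (-(v' * Real.log n)) ≤ (1 - ρ) ^ T := by
    refine le_trans (Real.exp_le_exp.2 (neg_le_neg ?_))
      (exp_neg_le_one_sub_pow (by linarith : ρ < 1) T)
    rw [← mul_div_assoc, div_le_iff₀ (by linarith)]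
    have : v ≤ v' * (1 - ρ) := by
      have h6 : v / v' ≤ 1 - ρ := by linarith
      rw [div_le_iff₀ (by linarith)] at h6
      linarith
    nlinarith
  have hbig : 4 ≤ (k n : ℝ) * (1 - ρ) ^ T := by
    calc 4 ≤ A * Real.exp ((θ - v') * Real.log n) := h4
      _ = A * Real.exp (θ * Real.log n) * Real.exp (-(v' * Real.log n)) := by
        rw [mul_assoc, ← Real.exp_add]; congr 2; ring
      _ ≤ k n * (1 - ρ) ^ T := by gcongr; exact hAB.1
  exact one_div_le_one_div_of_le (by norm_num) hbig

set_option maxHeartbeats 1000000 in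
/-- The nondefective possible defectives hide the defectives when there are too few tests. -/
lemma eventually_definiteDefectives_le_of_lt_one_sub (hθ0 : 0 < θ) (hθ1 : θ < 1)
    (hk : (fun n : ℕ => (k n : ℝ)) =Θ[atTop] fun n : ℕ => (n : ℝ) ^ θ)
    {u v M : ℝ} (hu : 0 < u) (hv0 : 0 < v) (hv : v < 1 - θ) (hM : 0 < M) :
    ∀ᶠ n : ℕ in atTop, ∀ (p : ℝ) (T : ℕ) (K : Finset (Fin n)), 0 ≤ p → p ≤ 1 → K.card = k n →
      T ≤ M * (k n * Real.log n) →
      u * Real.log n ≤ T * (p * (1 - p) ^ (k n - 1)) →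
      T * (p * (1 - p) ^ (k n - 1)) ≤ v * Real.log n →
      designMean p (fun x : Design T n => if definiteDefectives x (outcome x K) = K then 1 else 0)
        ≤ 1 / 4 := by
  obtain ⟨A, B, hA, hB, hAB⟩ := exists_growth_bounds hk
  set v' := (v + (1 - θ)) / 2 with hv'
  have hvv' : v < v' := by rw [hv']; linarith
  have hv'θ : v' < 1 - θ := by rw [hv']; linarith
  -- The relative excess of negative tests over their mean that the room between `v` and `v'` can
  -- absorb.
  set η := min (1 / 2) (v' / v - 1) with hη
  have hη0 : 0 < η := by
    refine lt_min (by norm_num) ?_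
    rw [sub_pos, one_lt_div hv0]; exact hvv'
  have hη2 : η ≤ 1 / 2 := min_le_left _ _
  have hηv : (1 + η) * v ≤ v' := by
    have : η ≤ v' / v - 1 := min_le_right _ _
    have h2 : 1 + η ≤ v' / v := by linarith
    rwa [le_div_iff₀ hv0] at h2
  have hktop := tendsto_defectives hθ0 hk
  have e1 : ∀ᶠ n in atTop, M * ((k n : ℝ) * (1 - η) ^ k n) < u * (1 - η) := by
    have h := ((tendsto_self_mul_const_pow_of_lt_one (r := 1 - η) (by linarith)
      (by linarith)).comp hktop).const_mul M
    rw [mul_zero] at h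
    exact h.eventually_lt_const (mul_pos hu (by linarith))
  have e2 := (tendsto_log_natCast.const_mul_atTop
    (by positivity : 0 < η ^ 2 / 4 * u)).eventually_ge_atTop (1 + Real.log 8)
  have e3 : ∀ᶠ n : ℕ in atTop, v * Real.log n * 8 ≤
      u / (2 * M * B) * Real.exp ((1 - θ - v') * Real.log n) := by
    have hpos : 0 < 1 - θ - v' := by linarith
    have h := (Real.tendsto_pow_mul_exp_neg_atTop_nhds_zero 1).comp
      (tendsto_log_natCast.const_mul_atTop hpos)
    have hc : 0 < (1 - θ - v') * (u / (2 * M * B)) / (8 * v) := by positivity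
    filter_upwards [h.eventually_lt_const hc] with n hn
    simp only [Function.comp, pow_one, Real.exp_neg] at hn
    rw [← div_eq_mul_inv, div_lt_div_iff₀ (Real.exp_pos _) (by positivity)] at hn
    have : (1 - θ - v') * (v * Real.log n * 8) ≤ (1 - θ - v') *
      (u / (2 * M * B) * Real.exp ((1 - θ - v') * Real.log n)) := by linarith
    exact le_of_mul_le_mul_left this hpos
  filter_upwards [hAB, e1, e2, e3, hktop.eventually_ge_atTop 1,
    eventually_two_mul_defectives_le hθ1 hk, tendsto_log_natCast.eventually_gt_atTop 0,
    eventually_gt_atTop 0] with n hAB e1 e2 e3 hk1 h2k hL hn p T K h0 h1 hK hTM hTu hTv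
  set L := Real.log n with hLdef
  set ρ := p * (1 - p) ^ (k n - 1) with hρ
  have hn' : (0 : ℝ) < n := by exact_mod_cast hn
  have hk' : (1 : ℝ) ≤ k n := by exact_mod_cast hk1
  have hpow : (1 - p) ^ k n = (1 - p) ^ (k n - 1) * (1 - p) := by
    rw [← pow_succ, Nat.sub_add_cancel hk1]
  have hq0 : 0 ≤ (1 - p) ^ (k n - 1) := pow_nonneg (by linarith) _
  have hq1 : (1 - p) ^ (k n - 1) ≤ 1 := pow_le_one₀ (by linarith) (by linarith)
  have hT0 : (0 : ℝ) ≤ T := Nat.cast_nonneg T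
  -- A larger p would make ρ exponentially small in k, and then T ≤ M k L contradicts T ρ ≥ u L.
  -- Afterwards this matters only through p ≤ 1/2.
  have hpη : p ≤ η := by
    by_contra hlt
    push Not at hlt
    have h2 : (1 - p) ^ (k n - 1) ≤ (1 - η) ^ (k n - 1) :=
      pow_le_pow_left₀ (by linarith) (by linarith) _
    have hηpow : (1 - η) ^ k n = (1 - η) ^ (k n - 1) * (1 - η) := by
      rw [← pow_succ, Nat.sub_add_cancel hk1]
    have h3 : M * (k n * (1 - η) ^ (k n - 1)) < u := by
      rw [hηpow] at e1
      refine lt_of_mul_lt_mul_right ?_ (by linarith : 0 ≤ 1 - η)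
      calc M * (k n * (1 - η) ^ (k n - 1)) * (1 - η) =
            M * (k n * ((1 - η) ^ (k n - 1) * (1 - η))) := by ring
        _ < u * (1 - η) := e1
    have h4 : u * L ≤ M * (k n * (1 - η) ^ (k n - 1)) * L := by
      calc u * L ≤ T * ρ := hTu
        _ ≤ M * (k n * L) * (1 * (1 - η) ^ (k n - 1)) := by rw [hρ]; gcongr
        _ = M * (k n * (1 - η) ^ (k n - 1)) * L := by ring
    exact absurd h4 (not_le.2 (mul_lt_mul_of_pos_right h3 hL))
  have hp1 : p < 1 := by linarith
  have hTρ : 0 < T * ρ := lt_of_lt_of_le (mul_pos hu hL) hTu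
  have hp : u / (M * k n) ≤ p := by
    rw [div_le_iff₀ (by positivity)]
    have hρp : ρ ≤ p := by rw [hρ]; exact mul_le_of_le_one_right h0 hq1
    have h4 : u * L ≤ p * (M * k n) * L := by
      calc u * L ≤ T * ρ := hTu
        _ ≤ M * (k n * L) * p := by gcongr
        _ = _ := by ring
    exact le_of_mul_le_mul_right h4 hL
  have hp0 : 0 < p := lt_of_lt_of_le (by positivity) hp
  set Q := T * (1 - p) ^ k n with hQ
  -- The key identity: the mean number of negative tests is tied to T ρ, so a small T ρ also means
  -- few eliminated nondefectives.
  have hQp : Q * p = T * ρ * (1 - p) := by rw [hQ, hρ, hpow]; ring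
  have hQ0 : 0 ≤ Q := mul_nonneg hT0 (pow_nonneg (by linarith) _)
  have hQu : u * L ≤ Q := by
    have : Q * p ≥ T * ρ * p := by rw [hQp]; gcongr; linarith
    exact hTu.trans (le_of_mul_le_mul_right this hp0)
  -- Rounding down loses at most 1, which costs η / 2 in the Chernoff exponent; the summand 1 in
  -- `e2` covers it.
  set a := ⌊(1 + η) * Q⌋₊ with ha
  have ha1 : (a : ℝ) ≤ (1 + η) * Q := Nat.floor_le (by positivity)
  have ha2 : (1 + η) * Q - 1 < a := by have := Nat.lt_floor_add_one ((1 + η) * Q); linarith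
  have hbound := designMean_definiteDefectives_le (T := T) h0 h1
    (K := K) (by rw [← Finset.card_pos]; omega) a (s := η / 2) (by positivity)
  refine hbound.trans ?_
  rw [hK]
  have hfirst : Real.exp (T * ((1 - p) ^ k n * (Real.exp (η / 2) - 1)) - η / 2 * a) ≤ 1 / 8 := by
    have hexp : Real.exp (η / 2) - 1 ≤ η / 2 * (1 + η / 2) := by
      have := Real.abs_exp_sub_one_sub_id_le (x := η / 2) (by rw [abs_of_pos] <;> linarith)
      have := (abs_le.1 this).2
      have e : η / 2 * (1 + η / 2) = η / 2 + (η / 2) ^ 2 := by ring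
      linarith
    have h5 : T * ((1 - p) ^ k n * (Real.exp (η / 2) - 1)) - η / 2 * a ≤ - Real.log 8 := by
      have h6 : T * ((1 - p) ^ k n * (Real.exp (η / 2) - 1)) ≤ Q * (η / 2 * (1 + η / 2)) := by
        rw [← mul_assoc]; gcongr
      have h7 : η / 2 * ((1 + η) * Q - 1) ≤ η / 2 * a := by gcongr
      have h8 : η ^ 2 / 4 * (u * L) ≤ η ^ 2 / 4 * Q := by gcongr
      have e : Q * (η / 2 * (1 + η / 2)) - η / 2 * ((1 + η) * Q - 1) =
        -(η ^ 2 / 4 * Q) + η / 2 := by ring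
      linarith
    calc _ ≤ Real.exp (-Real.log 8) := Real.exp_le_exp.2 h5
      _ = 1 / 8 := by rw [Real.exp_neg, Real.exp_log (by norm_num)]; norm_num
  have hsecond : T * ρ * (1 - p * (1 - p) ^ a) ^ (n - k n) ≤ 1 / 8 := by
    have hpa : Real.exp (-(v' * L)) ≤ (1 - p) ^ a := by
      refine le_trans (Real.exp_le_exp.2 (neg_le_neg ?_)) (exp_neg_le_one_sub_pow hp1 a)
      rw [← mul_div_assoc, div_le_iff₀ (by linarith)]
      calc a * p ≤ (1 + η) * Q * p := by gcongr
        _ = (1 + η) * (T * ρ) * (1 - p) := by rw [mul_assoc, hQp]; ring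
        _ ≤ (1 + η) * (v * L) * (1 - p) := by gcongr
        _ = (1 + η) * v * L * (1 - p) := by ring
        _ ≤ v' * L * (1 - p) := by gcongr
    set y := u / (2 * M * B) * Real.exp ((1 - θ - v') * L) with hy
    have hy0 : 0 < y := by positivity
    have hnk : (n : ℝ) / 2 ≤ ((n - k n : ℕ) : ℝ) := by
      have : n ≤ 2 * (n - k n) := by omega
      have : (n : ℝ) ≤ 2 * ((n - k n : ℕ) : ℝ) := by exact_mod_cast this
      linarith
    have hen : Real.exp L = n := Real.exp_log hn'
    have hyle : y ≤ ((n - k n : ℕ) : ℝ) * (p * (1 - p) ^ a) := by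
      calc y = Real.exp L / 2 * (u / (M * (B * Real.exp (θ * L))) * Real.exp (-(v' * L))) := by
            rw [hy, show (1 - θ - v') * L = L - θ * L + -(v' * L) by ring, Real.exp_add,
              Real.exp_sub]
            field_simp
        _ ≤ n / 2 * (u / (M * k n) * Real.exp (-(v' * L))) := by
            rw [hen]
            have := hAB.2
            gcongr
        _ ≤ _ := by gcongr
    have hx1 : p * (1 - p) ^ a ≤ 1 :=
      mul_le_one₀ h1 (pow_nonneg (by linarith) _) (pow_le_one₀ (by linarith) (by linarith))
    have hpw : (1 - p * (1 - p) ^ a) ^ (n - k n) ≤ 1 / y :=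
      one_sub_pow_le_one_div hx1 hy0 hyle
    calc T * ρ * (1 - p * (1 - p) ^ a) ^ (n - k n) ≤ v * L * (1 / y) := by gcongr
      _ ≤ 1 / 8 := by
          rw [mul_one_div, div_le_div_iff₀ hy0 (by norm_num)]
          linarith
  linarith

/-- The maximum achievable rate of DD is at most `min {1, (1 - θ) / θ} / (e ln 2)`. -/
theorem maxRate_DD_le (hθ0 : 0 < θ) (hθ1 : θ < 1)
    (hk : (fun n : ℕ => (k n : ℝ)) =Θ[atTop] fun n : ℕ => (n : ℝ) ^ θ) :
    maxRate DD k ≤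
      ((min 1 ((1 - θ) / θ) / (Real.exp 1 * Real.log 2) : ℝ) : EReal) := by
  refine iSup_le fun ⟨R, hR⟩ => EReal.coe_le_coe_iff.2 ?_
  by_contra hlt
  push Not at hlt
  have hln2 : 0 < Real.log 2 := Real.log_pos (by norm_num)
  have hmin0 : 0 < min 1 ((1 - θ) / θ) := lt_min one_pos (div_pos (by linarith) hθ0)
  have hR0 : 0 < R := lt_trans (by positivity) hlt
  -- The limiting upper bound for T ρ / log n at rate `R`. It is below max {θ, 1 - θ} exactly
  -- because `R` exceeds the claimed bound.
  set V := (1 - θ) / (R * Real.log 2) * Real.exp (-1) with hV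
  have hV0 : 0 < V := by have : 0 < 1 - θ := by linarith
                         positivity
  have hVlt : V < max θ (1 - θ) := by
    have hmax : max θ (1 - θ) * min 1 ((1 - θ) / θ) = 1 - θ := by
      rcases le_total θ (1 - θ) with h | h
      · rw [max_eq_right h, min_eq_left ((one_le_div hθ0).2 h), mul_one]
      · rw [max_eq_left h, min_eq_right ((div_le_one hθ0).2 h), mul_div_cancel₀ _ hθ0.ne']
    have h2 : min 1 ((1 - θ) / θ) < R * (Real.exp 1 * Real.log 2) := by
      rwa [div_lt_iff₀ (by positivity)] at hlt
    have h3 : V = (1 - θ) / (R * (Real.exp 1 * Real.log 2)) := by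
      rw [hV, Real.exp_neg]; field_simp
    rw [h3, div_lt_iff₀ (by positivity)]
    refine hmax.symm.trans_lt ?_
    exact mul_lt_mul_of_pos_left h2 (lt_of_lt_of_le hθ0 (le_max_left _ _))
  obtain ⟨v, hVv, hvmax⟩ := exists_between hVlt
  have hv0 : 0 < v := hV0.trans hVv
  obtain ⟨C, hC⟩ := exists_log_choose_le hk
  -- The factor 2 absorbs the constant `C`, which is eventually at most (1 - θ) log n.
  set M := 2 * (1 - θ) / (R * Real.log 2) with hM
  have hM0 : 0 < M := by have : 0 < 1 - θ := by linarith
                         positivity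
  have hLtop := tendsto_log_natCast
  have hktop := tendsto_defectives hθ0 hk
  have e1 := (hLtop.const_mul_atTop (sub_pos.2 hθ1)).eventually_ge_atTop C
  have e2 : ∀ᶠ n : ℕ in atTop, (k n : ℝ) / (k n - 1) *
      (((1 - θ) * Real.log n + C) / (R * Real.log 2)) * Real.exp (-1) ≤ v * Real.log n := by
    have t1 : Tendsto (fun n : ℕ => (1 : ℝ) + 1 / (k n - 1)) atTop (𝓝 (1 + 0)) := by
      refine tendsto_const_nhds.add ?_
      refine tendsto_const_nhds.div_atTop ?_
      exact tendsto_atTop_add_const_right _ (-1 : ℝ)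
        ((tendsto_natCast_atTop_atTop (R := ℝ)).comp hktop)
    have t2 : Tendsto (fun n : ℕ => (1 - θ) + C / Real.log n) atTop (𝓝 (1 - θ + 0)) :=
      tendsto_const_nhds.add (tendsto_const_nhds.div_atTop hLtop)
    have t3 := ((t1.mul (t2.div_const (R * Real.log 2))).mul_const (Real.exp (-1)))
    simp only [add_zero, one_mul] at t3
    filter_upwards [t3.eventually_lt_const hVv, hLtop.eventually_gt_atTop 0,
      hktop.eventually_ge_atTop 2] with n h1 hL hk2
    have hk2' : (2 : ℝ) ≤ k n := by exact_mod_cast hk2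
    have hk3 : (k n : ℝ) - 1 ≠ 0 := by linarith
    have h2 : (k n : ℝ) / (k n - 1) *
      (((1 - θ) * Real.log n + C) / (R * Real.log 2)) * Real.exp (-1) =
      (1 + 1 / ((k n : ℝ) - 1)) * ((1 - θ + C / Real.log n) / (R * Real.log 2)) * Real.exp (-1)
        * Real.log n := by
      field_simp
      ring
    rw [h2]
    exact mul_le_mul_of_nonneg_right h1.le hL.le
  have e3 : ∀ᶠ n : ℕ in atTop, ∀ (p : ℝ) (T : ℕ) (K : Finset (Fin n)), 0 ≤ p → p ≤ 1 →
      K.card = k n → T ≤ M * (k n * Real.log n) →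
      T * (p * (1 - p) ^ (k n - 1)) ≤ v * Real.log n →
      designMean p (fun x : Design T n => if definiteDefectives x (outcome x K) = K then 1 else 0)
        ≤ 1 / 4 := by
    -- When `v < 1 - θ`, the hiding argument needs T ρ bounded below by a multiple of log n. Below
    -- (θ / 2) log n the second moment bound takes over.
    rcases lt_max_iff.1 hvmax with h | h
    · filter_upwards [eventually_definiteDefectives_le_of_lt hθ0 hk hv0 h] with n hn
      exact fun p T K h0 h1 hK _ hT => hn p T K h0 h1 hK hT
    · filter_upwards [eventually_definiteDefectives_le_of_lt hθ0 hk (half_pos hθ0)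
        (half_lt_self hθ0), eventually_definiteDefectives_le_of_lt_one_sub hθ0 hθ1 hk
        (half_pos hθ0) hv0 h hM0] with n hn1 hn2 p T K h0 h1 hK hTM hT
      rcases le_total (T * (p * (1 - p) ^ (k n - 1))) (θ / 2 * Real.log n) with h | h
      · exact hn1 p T K h0 h1 hK h
      · exact hn2 p T K h0 h1 hK hTM h hT
  -- A single large `n` suffices: error below 1/2 contradicts success probability at most 1/4.
  obtain ⟨n, hach, hC, e1, e2, e3, h2k, hk2, hL⟩ := ((hR (1 / 2) (by norm_num)).and
    (hC.and (e1.and (e2.and (e3.and ((eventually_two_mul_defectives_le hθ1 hk).and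
    ((hktop.eventually_ge_atTop 2).and (hLtop.eventually_gt_atTop 0)))))))).exists
  obtain ⟨p, T, hT0, hRT, herr⟩ := hach
  have hT0' : (0 : ℝ) < T := by exact_mod_cast hT0
  have hk2' : (2 : ℝ) ≤ k n := by exact_mod_cast hk2
  have hCn := hC (by omega) (by omega)
  have hTle : (T : ℝ) ≤ k n * (((1 - θ) * Real.log n + C) / (R * Real.log 2)) := by
    rw [lt_div_iff₀ hT0', Real.logb, lt_div_iff₀ hln2] at hRT
    rw [← mul_div_assoc, le_div_iff₀ (by positivity)]
    linarith
  have hρ0 : 0 ≤ (p : ℝ) * (1 - p) ^ (k n - 1) :=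
    mul_nonneg p.2.1 (pow_nonneg (by linarith [p.2.2]) _)
  have hρ : (p : ℝ) * (1 - p) ^ (k n - 1) ≤ Real.exp (-1) / (k n - 1) := by
    rw [le_div_iff₀ (by linarith)]
    exact sole_probability_le p.2.2 (by omega)
  have hTρ : T * ((p : ℝ) * (1 - p) ^ (k n - 1)) ≤ v * Real.log n := by
    refine le_trans ?_ e2
    calc T * ((p : ℝ) * (1 - p) ^ (k n - 1)) ≤
          (k n * (((1 - θ) * Real.log n + C) / (R * Real.log 2))) * (Real.exp (-1) / (k n - 1)) := by
          gcongr
          exact hT0'.le.trans hTle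
      _ = _ := by ring
  have hTM : (T : ℝ) ≤ M * (k n * Real.log n) := by
    refine hTle.trans ?_
    calc (k n : ℝ) * (((1 - θ) * Real.log n + C) / (R * Real.log 2)) ≤
          k n * (((1 - θ) * Real.log n + (1 - θ) * Real.log n) / (R * Real.log 2)) := by gcongr
      _ = _ := by rw [hM]; ring
  have := le_errorProbability (A := DD) (T := T) (p := p) (b := 1 / 4) (by omega : k n ≤ n)
    fun K hK => by
      refine le_trans (le_of_eq ?_) (e3 p T K p.2.1 p.2.2 hK hTM hTρ)
      unfold DD
      congr 1
  linarith

end Converse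

/-! ### A rate above 1 / (e ln 2) for θ < 1/2 -/

section Achievability

lemma sum_Icc_pow_le {y : ℝ} (h0 : 0 ≤ y) (h1 : y ≤ 1 / 2) (m : ℕ) :
    ∑ l ∈ Finset.Icc 1 m, y ^ l ≤ 2 * y := by
  have hS : ∀ m : ℕ, ∑ l ∈ Finset.Icc 1 m, y ^ l ≤ 2 * y - 2 * y ^ (m + 1) := by
    intro m
    induction m with
    | zero => simp
    | succ m ih =>
      rw [Finset.sum_Icc_succ_top (by omega)]
      have : y ^ (m + 1 + 1) = y ^ (m + 1) * y := pow_succ _ _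
      have : 0 ≤ y ^ (m + 1) := by positivity
      nlinarith
  have := hS m
  have : 0 ≤ y ^ (m + 1) := by positivity
  linarith

/-- The number of tests meeting the defective set only in a given subset of size `l`: the exponent
of the lower tail. -/
lemma choose_mul_exp_le {κ l T : ℕ} {p L c s η θ γ B : ℝ} (hl : l ≤ κ)
    (h0 : 0 ≤ p) (h1 : p ≤ 1) (hpκ : p * κ = 1) (hL : 0 ≤ L) (hs : 0 ≤ s)
    (hT : c * (κ * L) ≤ T * (1 - p) ^ κ) (hγ : θ + γ ≤ c * (1 - Real.exp (-s)) - s * η)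
    (hB : (κ : ℝ) ≤ B * Real.exp (θ * L)) :
    κ.choose l * Real.exp (s * (η * (l * L)) -
      T * (((1 - p) ^ (κ - l) - (1 - p) ^ κ) * (1 - Real.exp (-s)))) ≤
      (B * Real.exp (-(γ * L))) ^ l := by
  have hq : (1 - p) ^ κ = (1 - p) ^ (κ - l) * (1 - p) ^ l := by
    rw [← pow_add, Nat.sub_add_cancel hl]
  -- This gives (1 - p)^(-l) ≥ 1 + l p, so the mean number of tests meeting `K` only in the subset
  -- is at least T (1 - p)^κ l p, linear in `l` for every `l`.
  have hbern : 1 + l * p ≤ (1 + p) ^ l := one_add_mul_le_pow (by linarith) l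
  have hprod : (1 - p) ^ l * (1 + l * p) ≤ 1 := by
    calc (1 - p) ^ l * (1 + l * p) ≤ (1 - p) ^ l * (1 + p) ^ l := by
          have : 0 ≤ (1 - p) ^ l := pow_nonneg (by linarith) _
          gcongr
      _ = (1 - p ^ 2) ^ l := by rw [← mul_pow]; congr 1; ring
      _ ≤ 1 := pow_le_one₀ (by nlinarith) (by nlinarith)
  have hr : (1 - p) ^ κ * (l * p) ≤ (1 - p) ^ (κ - l) - (1 - p) ^ κ := by
    have : 0 ≤ (1 - p) ^ (κ - l) := pow_nonneg (by linarith) _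
    have := mul_le_mul_of_nonneg_left hprod this
    rw [hq]; linarith
  have hlp : (0 : ℝ) ≤ l * p := by positivity
  have hTr : c * (l * L) ≤ T * ((1 - p) ^ (κ - l) - (1 - p) ^ κ) := by
    calc c * (l * L) = c * (κ * L) * (l * p) := by
          linear_combination (-(c * l * L)) * hpκ
      _ ≤ T * (1 - p) ^ κ * (l * p) := mul_le_mul_of_nonneg_right hT hlp
      _ = T * ((1 - p) ^ κ * (l * p)) := by ring
      _ ≤ _ := by gcongr
  have hes : 0 ≤ 1 - Real.exp (-s) := by
    have : Real.exp (-s) ≤ 1 := Real.exp_le_one_iff.2 (by linarith)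
    linarith
  have hexp : s * (η * (l * L)) -
      T * (((1 - p) ^ (κ - l) - (1 - p) ^ κ) * (1 - Real.exp (-s))) ≤ l * (-((θ + γ) * L)) := by
    have h3 := mul_le_mul_of_nonneg_right hTr hes
    have h4 := mul_le_mul_of_nonneg_right hγ (by positivity : (0 : ℝ) ≤ l * L)
    linarith
  have hch : (κ.choose l : ℝ) ≤ (B * Real.exp (θ * L)) ^ l := by
    calc (κ.choose l : ℝ) ≤ (κ : ℝ) ^ l := by exact_mod_cast Nat.choose_le_pow κ l
      _ ≤ _ := by gcongr
  calc _ ≤ (B * Real.exp (θ * L)) ^ l * Real.exp (l * (-((θ + γ) * L))) :=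
        mul_le_mul hch (Real.exp_le_exp.2 hexp) (Real.exp_pos _).le ((Nat.cast_nonneg _).trans hch)
    _ = (B * Real.exp (-(γ * L))) ^ l := by
        rw [Real.exp_nat_mul, ← mul_pow, mul_assoc, ← Real.exp_add]
        congr 3; ring

/-- The union bound over the sets at distance `l` from the defective set. -/
lemma choose_mul_choose_mul_le {n κ l : ℕ} {p L c η : ℝ} (hl0 : 0 < l) (hl : l ≤ κ)
    (h0 : 0 < p) (h1 : p < 1) (hpκ : p * κ = 1) (hc : 0 ≤ c) (hL : 0 ≤ L) (hηL : 2 ≤ η * L)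
    (hq : 1 / 4 ≤ (1 - p) ^ κ) :
    κ.choose l * ((n - κ).choose l *
      ((1 - p) ^ (l * (c * (κ * L))) * (1 - (1 - p) ^ l) ^ (η * (l * L)))) ≤
      (16 / 9 * Real.exp 2 * (n / κ) * Real.exp (-((c + η * Real.log (4 / 3)) * L))) ^ l := by
  have hl' : (0 : ℝ) < l := by exact_mod_cast hl0
  have hκ' : (0 : ℝ) < κ := by exact_mod_cast hl0.trans_le hl
  have hp1 : 0 < 1 - p := by linarith
  set β := 1 - (1 - p) ^ l with hβ
  have hβ0 : 0 < β := by
    have := pow_lt_one₀ hp1.le (by linarith) hl0.ne'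
    rw [hβ]; linarith
  have hβ1 : β ≤ 3 / 4 := by
    have : (1 - p) ^ κ ≤ (1 - p) ^ l := pow_le_pow_of_le_one hp1.le (by linarith) hl
    rw [hβ]; linarith
  have hβl : β ≤ l / κ := by
    have hb := one_add_mul_le_pow (a := -p) (by linarith) l
    have e : (l : ℝ) / κ = l * p := by
      rw [div_eq_iff hκ'.ne']; linear_combination (-(l : ℝ)) * hpκ
    rw [e, hβ]
    have : (1 - p) ^ l = (1 + -p) ^ l := by ring
    rw [this]; linarith
  -- Two of the η L factors are bounded by l / κ, which turns (e κ / l) (e n / l) into e² n / κ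
  -- uniformly in `l`. The others are bounded by 3/4 and give the extra power of n.
  have hβpow : β ^ (η * L) ≤ (l / κ) ^ 2 * (16 / 9 * Real.exp (-(η * Real.log (4 / 3) * L))) := by
    calc β ^ (η * L) = β ^ (2 : ℕ) * β ^ (η * L - 2) := by
          rw [← Real.rpow_natCast, ← Real.rpow_add hβ0]; congr 1; push_cast; ring
      _ ≤ (l / κ) ^ 2 * (3 / 4 : ℝ) ^ (η * L - 2) := by
          have := Real.rpow_le_rpow hβ0.le hβ1 (by linarith : 0 ≤ η * L - 2)
          gcongr
      _ = _ := by
          rw [Real.rpow_sub (by norm_num), Real.rpow_def_of_pos (by norm_num : (0 : ℝ) < 3 / 4)]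
          have : Real.log (3 / 4) = -Real.log (4 / 3) := by
            rw [← Real.log_inv]; norm_num
          rw [this]
          have e2 : (3 / 4 : ℝ) ^ (2 : ℝ) = 9 / 16 := by norm_num
          rw [e2, show -Real.log (4 / 3) * (η * L) = -(η * Real.log (4 / 3) * L) by ring]
          ring
  have hα : (1 - p) ^ (l * (c * (κ * L))) = (((1 - p) ^ (κ : ℝ)) ^ (c * L)) ^ l := by
    rw [← Real.rpow_natCast, ← Real.rpow_mul hp1.le, ← Real.rpow_mul hp1.le]
    congr 1; ring
  have hβ2 : β ^ (η * (l * L)) = (β ^ (η * L)) ^ l := by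
    rw [← Real.rpow_natCast, ← Real.rpow_mul hβ0.le]; congr 1; ring
  have hαle : ((1 - p) ^ (κ : ℝ)) ^ (c * L) ≤ Real.exp (-(c * L)) := by
    have h3 : (1 - p) ^ (κ : ℝ) ≤ Real.exp (-1) := by
      rw [Real.rpow_natCast]
      calc (1 - p) ^ κ ≤ Real.exp (-p) ^ κ :=
            pow_le_pow_left₀ hp1.le (Real.one_sub_le_exp_neg p) _
        _ = Real.exp (-1) := by rw [← Real.exp_nat_mul]; congr 1; linarith
    calc _ ≤ Real.exp (-1) ^ (c * L) :=
          Real.rpow_le_rpow (Real.rpow_nonneg hp1.le _) h3 (mul_nonneg hc hL)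
      _ = _ := by rw [← Real.exp_mul]; congr 1; ring
  have hch1 := choose_le_exp_mul_div_pow κ hl0
  have hch2 : ((n - κ).choose l : ℝ) ≤ (Real.exp 1 * n / l) ^ l :=
    le_trans (by exact_mod_cast Nat.choose_le_choose l (Nat.sub_le n κ))
      (choose_le_exp_mul_div_pow n hl0)
  rw [hα, hβ2]
  calc _ ≤ (Real.exp 1 * κ / l) ^ l * ((Real.exp 1 * n / l) ^ l * ((Real.exp (-(c * L))) ^ l *
        ((l / κ) ^ 2 * (16 / 9 * Real.exp (-(η * Real.log (4 / 3) * L)))) ^ l)) := by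
        have h3 : 0 ≤ ((1 - p) ^ (κ : ℝ)) ^ (c * L) := by positivity
        gcongr
    _ = _ := by
        rw [← mul_pow, ← mul_pow, ← mul_pow]
        congr 1
        have e1 : Real.exp (-((c + η * Real.log (4 / 3)) * L)) =
            Real.exp (-(c * L)) * Real.exp (-(η * Real.log (4 / 3) * L)) := by
          rw [← Real.exp_add]; congr 1; ring
        have e2 : Real.exp 2 = Real.exp 1 * Real.exp 1 := by rw [← Real.exp_add]; norm_num
        rw [e1, e2]
        field_simp

open Classical in
/-- The probability that a set of the size of `K` other than `K` explains the outcomes, for the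
Bernoulli parameter `p = 1 / K.card` and `K.card` of order `n ^ θ`. -/
lemma designMean_satisfying_le_of_growth {n T : ℕ} {p c₀ c₁ s s' η θ γ₀ γ₁ γ₂ A B : ℝ}
    (hp0 : 0 < p) (hp1 : p < 1) (hn : 0 < n) (K : Finset (Fin n)) (hpk : p * K.card = 1)
    (hs : 0 ≤ s) (hs' : 0 ≤ s') (hc : 0 ≤ c₀) (hL : 0 ≤ Real.log n) (hηL : 2 ≤ η * Real.log n)
    (hq : 1 / 4 ≤ (1 - p) ^ K.card)
    (hT : c₁ * (K.card * Real.log n) ≤ T * (1 - p) ^ K.card)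
    (hγ₀ : γ₀ ≤ c₁ * (1 - Real.exp (-s)) - s * c₀)
    (hγ₁ : θ + γ₁ ≤ c₁ * (1 - Real.exp (-s')) - s' * η)
    (hγ₂ : 1 - θ + γ₂ ≤ c₀ + η * Real.log (4 / 3)) (hA : 0 < A)
    (hAK : A * Real.exp (θ * Real.log n) ≤ K.card) (hBK : K.card ≤ B * Real.exp (θ * Real.log n))
    (h1 : B * Real.exp (-(γ₁ * Real.log n)) ≤ 1 / 2)
    (h2 : 16 / 9 * Real.exp 2 / A * Real.exp (-(γ₂ * Real.log n)) ≤ 1 / 2) :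
    designMean p (fun x : Design T n =>
      if ∃ L : Finset (Fin n), L ≠ K ∧ L.card = K.card ∧ outcome x L = outcome x K
        then 1 else 0) ≤
      Real.exp (-(γ₀ * (K.card * Real.log n))) + 2 * (B * Real.exp (-(γ₁ * Real.log n))) +
        2 * (16 / 9 * Real.exp 2 / A * Real.exp (-(γ₂ * Real.log n))) := by
  set L := Real.log n with hLdef
  have hn' : (0 : ℝ) < n := by exact_mod_cast hn
  have hk0 : (0 : ℝ) < K.card := lt_of_lt_of_le (by positivity) hAK
  have hB0 : 0 < B := pos_of_mul_pos_left (hk0.trans_le hBK) (Real.exp_pos _).le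
  have hmain := designMean_satisfying_le (T := T) hp0 hp1 K (c₀ * (K.card * L))
    (fun l => η * (l * L)) hs hs'
  refine hmain.trans ?_
  have hfirst : Real.exp (s * (c₀ * (K.card * L)) -
      T * ((1 - p) ^ K.card * (1 - Real.exp (-s)))) ≤ Real.exp (-(γ₀ * (K.card * L))) := by
    refine Real.exp_le_exp.2 ?_
    have hes : 0 ≤ 1 - Real.exp (-s) := by
      have : Real.exp (-s) ≤ 1 := Real.exp_le_one_iff.2 (by linarith)
      linarith
    have h3 := mul_le_mul_of_nonneg_right hT hes
    have h4 := mul_le_mul_of_nonneg_right hγ₀ (by positivity : 0 ≤ K.card * L)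
    linarith
  have hn2 : 16 / 9 * Real.exp 2 * (n / K.card) *
      Real.exp (-((c₀ + η * Real.log (4 / 3)) * L)) ≤
      16 / 9 * Real.exp 2 / A * Real.exp (-(γ₂ * L)) := by
    have hnk : (n : ℝ) / K.card ≤ Real.exp ((1 - θ) * L) / A := by
      rw [div_le_div_iff₀ hk0 hA]
      have e : Real.exp ((1 - θ) * L) * Real.exp (θ * L) = n := by
        rw [← Real.exp_add, ← add_mul, sub_add_cancel, one_mul, Real.exp_log hn']
      rw [← e]
      calc _ = Real.exp ((1 - θ) * L) * (A * Real.exp (θ * L)) := by ring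
        _ ≤ _ := mul_le_mul_of_nonneg_left hAK (Real.exp_pos _).le
    calc _ ≤ 16 / 9 * Real.exp 2 * (Real.exp ((1 - θ) * L) / A) *
          Real.exp (-((c₀ + η * Real.log (4 / 3)) * L)) := by gcongr
      _ = 16 / 9 * Real.exp 2 / A *
          Real.exp ((1 - θ) * L + -((c₀ + η * Real.log (4 / 3)) * L)) := by
          rw [Real.exp_add]; ring
      _ ≤ _ := by
          refine mul_le_mul_of_nonneg_left (Real.exp_le_exp.2 ?_) (by positivity)
          have := mul_le_mul_of_nonneg_right hγ₂ hL
          linarith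
  have hsum : ∑ l ∈ Finset.Icc 1 K.card, (K.card.choose l : ℝ) *
      (Real.exp (s' * (η * (l * L)) -
        T * (((1 - p) ^ (K.card - l) - (1 - p) ^ K.card) * (1 - Real.exp (-s')))) +
      (n - K.card).choose l *
        ((1 - p) ^ (l * (c₀ * (K.card * L))) * (1 - (1 - p) ^ l) ^ (η * (l * L)))) ≤
      ∑ l ∈ Finset.Icc 1 K.card, ((B * Real.exp (-(γ₁ * L))) ^ l +
        (16 / 9 * Real.exp 2 / A * Real.exp (-(γ₂ * L))) ^ l) := by
    refine Finset.sum_le_sum fun l hl => ?_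
    rw [Finset.mem_Icc] at hl
    rw [mul_add]
    exact add_le_add (choose_mul_exp_le hl.2 hp0.le hp1.le hpk hL hs' hT hγ₁ hBK)
      ((choose_mul_choose_mul_le hl.1 hl.2 hp0 hp1 hpk hc hL hηL hq).trans
        (pow_le_pow_left₀ (by positivity) hn2 l))
  rw [Finset.sum_add_distrib] at hsum
  have hs1 := sum_Icc_pow_le (y := B * Real.exp (-(γ₁ * L))) (by positivity) h1 K.card
  have hs2 := sum_Icc_pow_le (y := 16 / 9 * Real.exp 2 / A * Real.exp (-(γ₂ * L)))
    (by positivity) h2 K.card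
  linarith

variable {θ : ℝ} {k : ℕ → ℕ}

set_option maxHeartbeats 1000000 in
/-- For `θ < 1 / 2`, some rate above `1 / (e ln 2)` is achievable. -/
theorem exists_achievable_gt (hθ0 : 0 < θ) (hθ2 : θ < 1 / 2)
    (hk : (fun n : ℕ => (k n : ℝ)) =Θ[atTop] fun n : ℕ => (n : ℝ) ^ θ) :
    ∃ R : ℝ, 1 / (Real.exp 1 * Real.log 2) < R ∧ Achievable anySatisfyingSet k R := by
  have hθ1 : θ < 1 := by linarith
  have hln2 : 0 < Real.log 2 := Real.log_pos (by norm_num)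
  obtain ⟨A, B, hA, hB, hAB⟩ := exists_growth_bounds hk
  obtain ⟨C, hC⟩ := exists_le_log_choose hθ0 hθ1 hk
  -- With c1 > 1/2 this makes c1 (1 - e^(-s')) - θ at least g = 1/4 - θ/2, which is positive as θ <
  -- 1/2. The choice of `η` spends half of g on s' η.
  obtain ⟨s', hs', hexps'⟩ : ∃ s' : ℝ, 0 < s' ∧ Real.exp (-s') = (1 - 2 * θ) / 2 := by
    refine ⟨-Real.log ((1 - 2 * θ) / 2), ?_, ?_⟩
    · exact neg_pos.2 (Real.log_neg (by linarith) (by linarith))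
    · rw [neg_neg, Real.exp_log (by linarith)]
  set g := 1 / 4 - θ / 2 with hg
  have hg0 : 0 < g := by linarith
  set η := g / (2 * s') with hη
  have hη0 : 0 < η := by positivity
  have hs'η : s' * η = g / 2 := by rw [hη]; field_simp
  have hζ : 0 < Real.log (4 / 3) := Real.log_pos (by norm_num)
  set γ := η * Real.log (4 / 3) / 2 with hγ
  have hγ0 : 0 < γ := by positivity
  -- A chain c0 < c1 < c12 < c2 < 1 - θ: `c2` fixes the number of tests, `c12` allows for (1 -
  -- 1/k)^k being only near 1 / e, `c1` for rounding `T`, and `c0` is the threshold for negative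
  -- tests. It may lie `γ` below 1 - θ because the positive tests contribute 2γ.
  obtain ⟨c0, hc0, hc0'⟩ := exists_between
    (max_lt (by linarith : (1 / 2 : ℝ) < 1 - θ) (by linarith : 1 - θ - γ < 1 - θ))
  have hc0h : 1 / 2 < c0 := (le_max_left _ _).trans_lt hc0
  have hc0γ : 1 - θ - γ < c0 := (le_max_right _ _).trans_lt hc0
  obtain ⟨c1, hc01, hc1'⟩ := exists_between hc0'
  obtain ⟨c12, hc112, hc12'⟩ := exists_between hc1'
  obtain ⟨c2, hc122, hc2'⟩ := exists_between hc12'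
  -- Then c1 = c0 (1 + 2 s) > c0 (1 + s), so e^(-s) ≤ 1 / (1 + s) makes the lower-tail exponent
  -- positive.
  set s := (c1 / c0 - 1) / 2 with hs
  have hs0 : 0 < s := by
    have : 1 < c1 / c0 := (one_lt_div (by linarith)).2 hc01
    rw [hs]; linarith
  have hg1 : 0 < c1 * (1 - Real.exp (-s)) - s * c0 := by
    have h1 : Real.exp (-s) ≤ 1 / (1 + s) := by
      rw [Real.exp_neg, ← one_div]
      exact one_div_le_one_div_of_le (by linarith) (by linarith [Real.add_one_le_exp s])
    have h2 : c0 * (1 + s) < c1 := by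
      have : c1 = c0 * (1 + 2 * s) := by rw [hs]; field_simp; ring
      rw [this]; exact mul_lt_mul_of_pos_left (by linarith) (by linarith)
    have h3 : s * c0 < c1 * (1 - 1 / (1 + s)) := by
      have e : c1 * (1 - 1 / (1 + s)) = c1 * s / (1 + s) := by field_simp; ring
      rw [e, lt_div_iff₀ (by linarith)]
      have := mul_lt_mul_of_pos_left h2 hs0
      linarith
    have := mul_le_mul_of_nonneg_left h1 (by linarith : 0 ≤ c1)
    linarith
  set g1 := c1 * (1 - Real.exp (-s)) - s * c0 with hg1def
  have hRlt : 1 / (Real.exp 1 * Real.log 2) < (1 - θ) / (Real.exp 1 * c2 * Real.log 2) := by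
    rw [div_lt_div_iff₀ (by positivity) (by have : 0 < c2 := by linarith
                                            positivity)]
    have := mul_lt_mul_of_pos_right hc2' (by positivity : 0 < Real.exp 1 * Real.log 2)
    linarith
  obtain ⟨R, hR1, hR2⟩ := exists_between hRlt
  refine ⟨R, hR1, fun ε hε => ?_⟩
  have hktop := tendsto_defectives hθ0 hk
  have hLtop := tendsto_log_natCast
  have hkR : Tendsto (fun n => (k n : ℝ)) atTop atTop := tendsto_natCast_atTop_atTop.comp hktop
  have hkL : Tendsto (fun n : ℕ => (k n : ℝ) * Real.log n) atTop atTop := hkR.atTop_mul_atTop₀ hLtop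
  have hq := (Real.tendsto_one_add_div_pow_exp (-1)).comp hktop
  have hy1 : Tendsto (fun n : ℕ => B * Real.exp (-(g / 2 * Real.log n))) atTop (𝓝 0) := by
    have := (Real.tendsto_exp_neg_atTop_nhds_zero.comp
      (hLtop.const_mul_atTop (half_pos hg0))).const_mul B
    rwa [mul_zero] at this
  have hy2 : Tendsto (fun n : ℕ => 16 / 9 * Real.exp 2 / A * Real.exp (-(γ * Real.log n)))
      atTop (𝓝 0) := by
    have := (Real.tendsto_exp_neg_atTop_nhds_zero.comp
      (hLtop.const_mul_atTop hγ0)).const_mul (16 / 9 * Real.exp 2 / A)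
    rwa [mul_zero] at this
  have hm : 0 < min (1 / 2) (ε / 12) := lt_min (by norm_num) (by positivity)
  have he3 : Real.exp 1 < 4 := by linarith [Real.exp_one_lt_d9]
  have hq1 : (1 / 4 : ℝ) < Real.exp (-1) := by
    rw [Real.exp_neg, ← one_div]
    exact one_div_lt_one_div_of_lt (Real.exp_pos 1) he3
  have hq2 : c12 / (Real.exp 1 * c2) < Real.exp (-1) := by
    have : 0 < c2 := by linarith
    rw [Real.exp_neg, div_lt_iff₀ (by positivity)]
    have : (Real.exp 1)⁻¹ * (Real.exp 1 * c2) = c2 := by field_simp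
    rw [this]; exact hc122
  have hRlog : ∀ᶠ n : ℕ in atTop,
      R * (Real.exp 1 * c2 * Real.log n) * Real.log 2 < (1 - θ) * Real.log n - C := by
    have : 0 < c2 := by linarith
    have hpos : 0 < 1 - θ - R * (Real.exp 1 * c2) * Real.log 2 := by
      rw [lt_div_iff₀ (by positivity)] at hR2
      linarith
    filter_upwards [(hLtop.const_mul_atTop hpos).eventually_gt_atTop C] with n hn
    linarith
  filter_upwards [hAB, hC, hktop.eventually_ge_atTop 2, eventually_two_mul_defectives_le hθ1 hk,
    hLtop.eventually_ge_atTop (2 / η), hkL.eventually_ge_atTop (c12 - c1)⁻¹,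
    hkL.eventually_ge_atTop (Real.log (6 / ε) / g1), hq.eventually_const_lt hq1,
    hq.eventually_const_lt hq2, hy1.eventually_lt_const hm, hy2.eventually_lt_const hm, hRlog,
    hkL.eventually_ge_atTop 2, eventually_gt_atTop 0]
    with n hAB hC hk2 h2k hηL hkL1 hkL2 hq1 hq2 hy1 hy2 hRlog hkL3 hn
  simp only [Function.comp] at hq1 hq2
  set L := Real.log n with hL
  have hn' : (0 : ℝ) < n := by exact_mod_cast hn
  have hk' : (2 : ℝ) ≤ k n := by exact_mod_cast hk2
  have hL0 : 0 < L := lt_of_lt_of_le (by positivity) hηL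
  have hc2pos : 0 < c2 := by linarith
  -- This is the choice ν = 1, for which a test is negative with probability tending to 1 / e.
  set p : ℝ := 1 / k n with hp
  have hp0 : 0 < p := by positivity
  have hp1 : p < 1 := by rw [hp, div_lt_one (by linarith)]; linarith
  have hpk : p * k n = 1 := by rw [hp]; field_simp
  have hpq : (1 + -1 / (k n : ℝ)) ^ k n = (1 - p) ^ k n := by rw [hp]; congr 1; ring
  rw [hpq] at hq1 hq2
  set q := (1 - p) ^ k n with hqdef
  have hqle : q ≤ 1 := pow_le_one₀ (by linarith) (by linarith)
  set T := ⌊Real.exp 1 * c2 * (k n * L)⌋₊ with hT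
  have hTle : (T : ℝ) ≤ Real.exp 1 * c2 * (k n * L) := Nat.floor_le (by positivity)
  have hTge : Real.exp 1 * c2 * (k n * L) - 1 ≤ T := by
    have := Nat.lt_floor_add_one (Real.exp 1 * c2 * (k n * L)); linarith
  have hT0 : 0 < T := by
    have h1 : (1 : ℝ) < Real.exp 1 := by have := Real.add_one_lt_exp (one_ne_zero); linarith
    refine Nat.floor_pos.2 ?_
    have : 1 / 2 * 2 ≤ c2 * (k n * L) := by gcongr; linarith
    have := mul_le_mul h1.le this (by norm_num) (Real.exp_pos 1).le
    linarith
  have hT0' : (0 : ℝ) < T := by exact_mod_cast hT0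
  have hTq : c1 * (k n * L) ≤ T * q := by
    have h1 : c12 * (k n * L) ≤ Real.exp 1 * c2 * (k n * L) * q := by
      rw [div_lt_iff₀ (by positivity)] at hq2
      have : c12 * (k n * L) ≤ q * (Real.exp 1 * c2) * (k n * L) := by gcongr
      linarith
    have h2 : 1 ≤ (c12 - c1) * (k n * L) := by
      have := (inv_le_iff_one_le_mul₀ (by linarith : 0 < c12 - c1)).1 hkL1
      linarith
    have h3 : (Real.exp 1 * c2 * (k n * L) - 1) * q ≤ T * q := by
      have : 0 ≤ q := by linarith
      gcongr
    linarith
  refine ⟨⟨p, hp0.le, hp1.le⟩, T, hT0, ?_, ?_⟩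
  · rw [lt_div_iff₀ hT0', Real.logb, lt_div_iff₀ hln2]
    have hR0 : 0 < R := lt_trans (by positivity) hR1
    calc R * T * Real.log 2 ≤ R * (Real.exp 1 * c2 * (k n * L)) * Real.log 2 := by gcongr
      _ = k n * (R * (Real.exp 1 * c2 * L) * Real.log 2) := by ring
      _ < k n * ((1 - θ) * L - C) := by gcongr
      _ ≤ _ := hC
  · refine lt_of_le_of_lt (errorProbability_le (b := 5 / 6 * ε) (by omega) fun K hK => ?_)
      (by linarith)
    have hfirst : Real.exp (-(g1 * (k n * L))) ≤ ε / 6 := by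
      have h2 : Real.log (6 / ε) ≤ g1 * (k n * L) := by
        rw [div_le_iff₀ hg1] at hkL2; linarith
      calc _ ≤ Real.exp (-Real.log (6 / ε)) := Real.exp_le_exp.2 (by linarith)
        _ = ε / 6 := by rw [Real.exp_neg, Real.exp_log (by positivity), inv_div]
    have hm1 := min_le_left (1 / 2) (ε / 12)
    have hm2 := min_le_right (1 / 2) (ε / 12)
    have hηL2 : 2 ≤ η * L := by rw [div_le_iff₀ hη0] at hηL; linarith
    have hexpo : θ + g / 2 ≤ c1 * (1 - Real.exp (-s')) - s' * η := by
      rw [hexps', hs'η]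
      have : (1 / 2) * (1 - (1 - 2 * θ) / 2) ≤ c1 * (1 - (1 - 2 * θ) / 2) :=
        mul_le_mul_of_nonneg_right (by linarith) (by linarith)
      linarith
    have hmain := designMean_satisfying_le_of_growth (T := T) hp0 hp1 hn K
      (by rw [hK]; exact hpk) hs0.le hs'.le (by linarith : 0 ≤ c0) hL0.le hηL2
      (by rw [hK]; exact hq1.le) (by rw [hK]; exact hTq) le_rfl hexpo
      (by linarith : 1 - θ + γ ≤ c0 + η * Real.log (4 / 3)) hA
      (by rw [hK]; exact hAB.1) (by rw [hK]; exact hAB.2) (by linarith) (by linarith)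
    refine le_trans (designMean_mono hp0.le hp1.le fun x => ?_) (hmain.trans ?_)
    · by_cases h : anySatisfyingSet n (k n) T x (outcome x K) = K
      · rw [if_neg (not_not.2 h)]; split_ifs <;> norm_num
      · rw [if_pos h, if_pos]
        exact exists_satisfying_of_anySatisfyingSet_ne (by rw [hK]; exact h)
    · rw [hK]
      linarith

end Achievability

/-! ### The one-parameter maxima and the numerical threshold -/

section Maxima

/-- A continuous function on the positive reals that is dominated by a multiple of `ν e^{-ν}` and
positive at `1` attains a maximum. -/
lemma exists_isGreatest_image_Ioi {F : ℝ → ℝ} (hF : ContinuousOn F (Set.Ioi 0)) {c : ℝ}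
    (hc : 0 < c) (hle : ∀ ν, 0 < ν → F ν ≤ c * (ν * Real.exp (-ν))) (h1 : 0 < F 1) :
    ∃ B, IsGreatest (F '' Set.Ioi 0) B := by
  -- Outside [a, b] the dominating function is at most `F 1`: below `a` because e^(-ν) ≤ 1, above
  -- `b` because e^ν ≥ ν² / 2. So a maximum over the compact interval is global.
  set a := min 1 (F 1 / c) with ha
  set b := max 1 (2 * c / F 1) with hb
  have ha0 : 0 < a := lt_min one_pos (by positivity)
  have ha1 : a ≤ 1 := min_le_left _ _
  have hb1 : 1 ≤ b := le_max_left _ _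
  obtain ⟨ν₀, hν₀, hmax⟩ := isCompact_Icc.exists_isMaxOn (Set.nonempty_Icc.2 (ha1.trans hb1))
    (hF.mono fun ν (hν : ν ∈ Set.Icc a b) => ha0.trans_le hν.1)
  have hmax1 : F 1 ≤ F ν₀ := hmax ⟨ha1, hb1⟩
  refine ⟨F ν₀, ⟨ν₀, ha0.trans_le hν₀.1, rfl⟩, ?_⟩
  rintro _ ⟨ν, hν, rfl⟩
  have hν0 : 0 < ν := hν
  rcases lt_or_ge ν a with h | h
  · refine le_trans ((hle ν hν0).trans ?_) hmax1
    have h2 : ν ≤ F 1 / c := h.le.trans (min_le_right _ _)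
    rw [le_div_iff₀ hc] at h2
    have h3 : Real.exp (-ν) ≤ 1 := Real.exp_le_one_iff.2 (by linarith)
    have h4 : ν * Real.exp (-ν) ≤ ν := mul_le_of_le_one_right hν0.le h3
    have h5 := mul_le_mul_of_nonneg_left h4 hc.le
    linarith
  rcases lt_or_ge b ν with h' | h'
  · refine le_trans ((hle ν hν0).trans ?_) hmax1
    have h2 : 2 * c / F 1 ≤ ν := (le_max_right _ _).trans h'.le
    rw [div_le_iff₀ h1] at h2
    have h3 := Real.quadratic_le_exp_of_nonneg hν0.le
    rw [Real.exp_neg, ← div_eq_mul_inv, ← mul_div_assoc, div_le_iff₀ (Real.exp_pos _)]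
    have h4 : ν ^ 2 / 2 ≤ Real.exp ν := by linarith
    calc c * ν ≤ ν * F 1 / 2 * ν := by nlinarith
      _ = F 1 * (ν ^ 2 / 2) := by ring
      _ ≤ F 1 * Real.exp ν := by gcongr
  · exact hmax ⟨h, h'⟩

lemma second_term_eq (θ ν : ℝ) :
    ν / (Real.exp ν * Real.log 2) * ((1 - θ) / θ) =
      (1 - θ) / θ / Real.log 2 * (ν * Real.exp (-ν)) := by
  rw [Real.exp_neg]; field_simp

lemma continuous_second_term (θ : ℝ) :
    Continuous fun ν : ℝ => ν / (Real.exp ν * Real.log 2) * ((1 - θ) / θ) := by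
  simp_rw [second_term_eq]
  fun_prop

/-- At ν = 1 the first term is 1 / (e ln 2) plus a nonnegative quantity, and the second is exactly
(1 - θ) / θ times 1 / (e ln 2). -/
lemma min_div_le_ddMinimum_one {θ : ℝ} :
    min 1 ((1 - θ) / θ) / (Real.exp 1 * Real.log 2) ≤ ddMinimum θ 1 := by
  have hln2 : 0 < Real.log 2 := Real.log_pos (by norm_num)
  have he : Real.exp (-1) < 1 := Real.exp_lt_one_iff.2 (by norm_num)
  have hpos : 0 < Real.exp 1 * Real.log 2 := by positivity
  refine le_min ?_ ?_
  · have h1 : Real.exp (-1) * Real.logb 2 (Real.exp 1) = 1 / (Real.exp 1 * Real.log 2) := by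
      rw [Real.logb, Real.log_exp, Real.exp_neg]; field_simp
    have h2 : 0 ≤ 1 * Real.exp (-1) * Real.logb 2 (1 / (1 - Real.exp (-1))) := by
      refine mul_nonneg (by positivity) (Real.logb_nonneg (by norm_num) ?_)
      rw [one_le_div (by linarith)]
      linarith [Real.exp_pos (-1)]
    rw [h1]
    have h3 : min 1 ((1 - θ) / θ) / (Real.exp 1 * Real.log 2) ≤ 1 / (Real.exp 1 * Real.log 2) := by
      gcongr; exact min_le_left _ _
    linarith
  · calc _ ≤ (1 - θ) / θ / (Real.exp 1 * Real.log 2) := by gcongr; exact min_le_right _ _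
      _ = _ := by ring

lemma exists_isGreatest_ddMinimum {θ : ℝ} (hθ0 : 0 < θ) (hθ1 : θ < 1) :
    ∃ B, IsGreatest (ddMinimum θ '' Set.Ioi 0) B := by
  have hln2 : 0 < Real.log 2 := Real.log_pos (by norm_num)
  have hθ' : 0 < (1 - θ) / θ := div_pos (by linarith) hθ0
  refine exists_isGreatest_image_Ioi (c := (1 - θ) / θ / Real.log 2) ?_ (by positivity)
    (fun ν _ => ?_) ?_
  · unfold ddMinimum Real.logb
    refine ContinuousOn.inf ?_ (continuous_second_term θ).continuousOn
    simp only [Real.log_exp]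
    refine ContinuousOn.add (by fun_prop) (ContinuousOn.mul (by fun_prop)
      (ContinuousOn.div_const (ContinuousOn.log ?_ ?_) _))
    · refine ContinuousOn.div₀ continuousOn_const (by fun_prop) fun ν hν => ?_
      have : Real.exp (-ν) < 1 := Real.exp_lt_one_iff.2 (neg_lt_zero.2 hν)
      linarith
    · intro ν hν
      have : Real.exp (-ν) < 1 := Real.exp_lt_one_iff.2 (neg_lt_zero.2 hν)
      exact one_div_ne_zero (by linarith)
  · rw [← second_term_eq]
    exact min_le_right _ _
  · refine lt_of_lt_of_le ?_ min_div_le_ddMinimum_one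
    have := lt_min one_pos hθ'
    positivity

/-- One summand of h(1 / e) is already 1 / (e ln 2) and the other is positive; in the second term (1
- θ) / θ > 1. -/
lemma one_div_lt_capacityMinimum_one {θ : ℝ} (hθ0 : 0 < θ) (hθ2 : θ < 1 / 2) :
    1 / (Real.exp 1 * Real.log 2) < capacityMinimum θ 1 := by
  have hln2 : 0 < Real.log 2 := Real.log_pos (by norm_num)
  have he : Real.exp (-1) < 1 := Real.exp_lt_one_iff.2 (by norm_num)
  have hpos : 0 < Real.exp 1 * Real.log 2 := by positivity
  refine lt_min ?_ ?_
  · rw [← div_div]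
    refine div_lt_div_of_pos_right ?_ hln2
    have h1 : Real.exp (-1) * Real.log (Real.exp (-1))⁻¹ = 1 / Real.exp 1 := by
      rw [Real.log_inv, Real.log_exp, Real.exp_neg]; ring
    have h2 : 0 < (1 - Real.exp (-1)) * Real.log (1 - Real.exp (-1))⁻¹ := by
      refine mul_pos (by linarith) (Real.log_pos ?_)
      rw [one_lt_inv₀ (by linarith)]
      linarith [Real.exp_pos (-1)]
    rw [Real.binEntropy, h1]
    linarith
  · refine lt_mul_of_one_lt_right (by positivity) ?_
    rw [one_lt_div hθ0]
    linarith

lemma exists_isGreatest_capacityMinimum {θ : ℝ} (hθ0 : 0 < θ) (hθ2 : θ < 1 / 2) :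
    ∃ C, IsGreatest (capacityMinimum θ '' Set.Ioi 0) C := by
  have hln2 : 0 < Real.log 2 := Real.log_pos (by norm_num)
  have hθ' : 0 < (1 - θ) / θ := div_pos (by linarith) hθ0
  refine exists_isGreatest_image_Ioi (c := (1 - θ) / θ / Real.log 2) ?_ (by positivity)
    (fun ν _ => ?_) ?_
  · unfold capacityMinimum
    have := Real.binEntropy_continuous
    exact ContinuousOn.inf (by fun_prop) (continuous_second_term θ).continuousOn
  · rw [← second_term_eq]
    exact min_le_right _ _
  · exact lt_trans (by positivity) (one_div_lt_capacityMinimum_one hθ0 hθ2)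

/-- Since θ* = 1 / (3 - log (e - 1)), it is enough that log (e - 1) lies between 0.54 and 0.546,
which Taylor bounds for the exponential at these points confirm. -/
lemma abs_thetaStar_sub_lt : |thetaStar - 0.407| < 0.0005 := by
  have he1 := Real.exp_one_gt_d9
  have he2 := Real.exp_one_lt_d9
  have hlog : Real.log (1 - Real.exp (-1)) = Real.log (Real.exp 1 - 1) - 1 := by
    have e : 1 - Real.exp (-1) = (Real.exp 1 - 1) / Real.exp 1 := by
      rw [Real.exp_neg]; field_simp
    rw [e, Real.log_div (by linarith) (Real.exp_pos 1).ne', Real.log_exp]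
  have hlow : 0.54 < Real.log (Real.exp 1 - 1) := by
    rw [Real.lt_log_iff_exp_lt (by linarith)]
    have h := Real.exp_bound' (x := 0.54) (by norm_num) (by norm_num) (n := 6) (by norm_num)
    simp only [Finset.sum_range_succ, Finset.sum_range_zero, Nat.factorial] at h
    norm_num at h ⊢
    linarith
  have hupp : Real.log (Real.exp 1 - 1) < 0.546 := by
    rw [Real.log_lt_iff_lt_exp (by linarith)]
    have h := Real.sum_le_exp_of_nonneg (x := 0.546) (by norm_num) 5
    simp only [Finset.sum_range_succ, Finset.sum_range_zero, Nat.factorial] at h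
    norm_num at h ⊢
    linarith
  rw [thetaStar, hlog, abs_lt, lt_sub_iff_add_lt, sub_lt_iff_lt_add, lt_div_iff₀ (by linarith),
    div_lt_iff₀ (by linarith)]
  constructor <;> norm_num at * <;> linarith

end Maxima

end GroupTesting

end

/-- Let `0 < θ < 1` and `k n = Θ(n^θ)`. The maximum achievable rate of DD is at most the maximum
`B` over `ν > 0` of `ddMinimum θ ν`. If `θ < θ*`, then DD is strictly suboptimal: its maximum
achievable rate is less than the capacity of Bernoulli nonadaptive group testing, and less than the
value `C`, the maximum over `ν > 0` of `capacityMinimum θ ν`. Here `θ* = 0.407` to three places. -/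
theorem theorem1 (θ : ℝ) (hθ0 : 0 < θ) (hθ1 : θ < 1) (k : ℕ → ℕ)
    (hk : (fun n : ℕ => (k n : ℝ)) =Θ[Filter.atTop] fun n : ℕ => (n : ℝ) ^ θ) :
    (∃ B : ℝ, IsGreatest (GroupTesting.ddMinimum θ '' Set.Ioi 0) B ∧
      GroupTesting.maxRate GroupTesting.DD k ≤ (B : EReal)) ∧
    (θ < GroupTesting.thetaStar →
      GroupTesting.maxRate GroupTesting.DD k < GroupTesting.capacity k ∧
      ∃ C : ℝ, IsGreatest (GroupTesting.capacityMinimum θ '' Set.Ioi 0) C ∧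
        GroupTesting.maxRate GroupTesting.DD k < (C : EReal)) ∧
    |GroupTesting.thetaStar - 0.407| < 0.0005 := by
  have hDD := GroupTesting.maxRate_DD_le hθ0 hθ1 hk
  refine ⟨?_, fun hθ => ?_, GroupTesting.abs_thetaStar_sub_lt⟩
  · obtain ⟨B, hB⟩ := GroupTesting.exists_isGreatest_ddMinimum hθ0 hθ1
    refine ⟨B, hB, hDD.trans (EReal.coe_le_coe_iff.2 ?_)⟩
    exact GroupTesting.min_div_le_ddMinimum_one.trans (hB.2 ⟨1, Set.mem_Ioi.2 one_pos, rfl⟩)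
  -- The exact value of θ* plays no further role; the argument separates DD from the capacity for
  -- every θ < 1/2.
  · have hθ2 : θ < 1 / 2 := by
      have := (abs_lt.1 GroupTesting.abs_thetaStar_sub_lt).2
      norm_num at this ⊢
      linarith
    have hDD1 : GroupTesting.maxRate GroupTesting.DD k ≤
        ((1 / (Real.exp 1 * Real.log 2) : ℝ) : EReal) := by
      refine hDD.trans (EReal.coe_le_coe_iff.2 ?_)
      have : 0 < Real.log 2 := Real.log_pos (by norm_num)
      gcongr
      exact min_le_left _ _
    constructor
    · obtain ⟨R, hR, hach⟩ := GroupTesting.exists_achievable_gt hθ0 hθ2 hk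
      refine (hDD1.trans_lt (EReal.coe_lt_coe_iff.2 hR)).trans_le ?_
      exact (le_iSup (fun R : {R : ℝ // GroupTesting.Achievable GroupTesting.anySatisfyingSet k R} =>
        ((R : ℝ) : EReal)) ⟨R, hach⟩).trans
        (le_iSup (fun A => GroupTesting.maxRate A k) GroupTesting.anySatisfyingSet)
    · obtain ⟨C, hC⟩ := GroupTesting.exists_isGreatest_capacityMinimum hθ0 hθ2
      refine ⟨C, hC, hDD1.trans_lt (EReal.coe_lt_coe_iff.2 ?_)⟩
      exact (GroupTesting.one_div_lt_capacityMinimum_one hθ0 hθ2).trans_le (hC.2 ⟨1, Set.mem_Ioi.2 one_pos, rfl⟩)
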